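/- **Setting.** Let $X\neq\{0\}$ be a (complex, not necessarily unital) C*-algebra and $\mathcal F$ a norm-closed linear subspace of $X^*$ such that: (b) $\|x\|=\sup\{|\varphi(x)|:\varphi\in\mathcal F,\ \|\varphi\|\le 1\}$ for $x\in X$; (c) $\|\varphi\|=\sup\{|\varphi(x)|:\|x\|\le1\}$ for $\varphi\in\mathcal F$; (d) the convex hull of every relatively $\sigma(X,\mathcal F)$-compact subset of $X$ is relatively $\sigma(X,\mathcal F)$-compact; (e) the convex hull of every relatively $\sigma(\mathcal F,X)$-compact subset of $\mathcal F$ is relatively $\sigma(\mathcal F,X)$-compact; (f) the involution of $X$ is $\mathcal F$-continuous and the multiplication of $X$ is separately $\mathcal F$-continuous. Here the $\mathcal F$-topology is $\sigma(X,\mathcal F)$. Let $G$ be a compact Hausdorff group with normalized Haar measure $dg$, and let $\alpha:G\to\mathrm{Aut}(X)$ be a homomorphism into the group of $\mathcal F$-continuous $*$-automorphisms of $X$ such that $g\mapsto\varphi(\alpha_g(x))$ is continuous for all $x\in X$, $\varphi\in\mathcal F$. (So $(X,G,\alpha)$ is an $\mathcal F$-dynamical system with $G$ compact.) Let $\widehat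 G$ be the set of unitary equivalence classes of irreducible continuous unitary representations of $G$; for each class fix a representative $\pi$ on a Hilbert space $H_\pi$ of finite dimension $d_\pi$, written as a unitary matrix $[\pi_{ij}]$ in an orthonormal basis. Put $\chi_\pi(g)=d_\pi\sum_i\overline{\pi_{ii}(g)}$ and $$X_1(\pi)=\Big\{x\in X:\ x=\int_G\chi_\pi(g)\,\alpha_g(x)\,dg\Big\},$$ the integral being weak, i.e. tested against every $\varphi\in\mathcal F$. Let $sp(\alpha)=\{\pi\in\widehat G: X_1(\pi)\ne\{0\}\}$. For an $\alpha$-invariant $*$-subalgebra $Y\subset X$, identify $Y\otimes B(H_\pi)$ with the $d_\pi\times d_\pi$ matrices over $Y$. Let $(Y\otimes B(H_\pi))^{\alpha\otimes ad\pi}$ be the fixed point algebra of the action $a=[a_{ij}]\mapsto(1\otimes\pi_g)[\alpha_g(a_{ij})](1\otimes\pi_g^*)$, let $$Y_2(\pi)=\{a\in Y\otimes B(H_\pi):\ [\alpha_g(a_{ij})]=a(1\otimes\pi_g)\ \text{for all } g\in G\},$$ and let $Y_2(\pi)^*Y_2(\pi)$ be the linear span of the products $a^*b$ with $a,b\in Y_2(\pi)$.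 A two-sided ideal (not assumed closed) $I$ of an algebra $B$ is *essential* if $b\in B$, $bI=\{0\}$ imply $b=0$. A $*$-subalgebra $B$ of $X\otimes B(H_\pi)$ is *$\mathcal F$-prime* if every non-zero two-sided ideal of $B$ is essential in $B$; $X$ is *$\alpha$-prime* if every non-zero $\alpha$-invariant two-sided ideal of $X$ is essential in $X$. Let $\mathcal H^\alpha_\sigma(X)$ be the set of non-zero $\alpha$-invariant $\mathcal F$-closed hereditary C*-subalgebras of $X$. For $Y\in\mathcal H^\alpha_\sigma(X)$ let $sp_{\mathcal F}(\alpha|_Y)$ be the set of $\pi\in\widehat G$ for which the closure of $Y_2(\pi)^*Y_2(\pi)$ in the (entrywise) $\mathcal F\otimes B(H_\pi)^*$-topology is essential in $(Y\otimes B(H_\pi))^{\alpha\otimes ad\pi}$. The Connes spectrum is $$\Gamma_{\mathcal F}(\alpha)=\bigcap\{sp_{\mathcal F}(\alpha|_Y):Y\in\mathcal H^\alpha_\sigma(X)\}.$$ **Theorem.** The following conditions are equivalent: (i) $(X\otimes B(H_\pi))^{\alpha\otimes ad\pi}$ is $\mathcal F$-prime for all $\pi\in sp(\alpha)$; (ii)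 $X$ is $\alpha$-prime and $sp(\alpha)=\Gamma_{\mathcal F}(\alpha)$. -/

import Mathlib

open scoped Topology

noncomputable section

namespace CompactAction

/-! ### Dual pairs of Banach spaces and the `F`-topology -/

section DualPair

variable {X : Type*} [NonUnitalCStarAlgebra X]

/-- The canonical pairing `(x, φ) ↦ φ x` between `X` and a space `F` of bounded functionals. -/
def pairing (F : Submodule ℂ (StrongDual ℂ X)) : X →ₗ[ℂ] F →ₗ[ℂ] ℂ :=
  LinearMap.flip ((ContinuousLinearMap.coeLM ℂ).comp F.subtype)

/-- The `F`-topology on `X`, that is, the weak topology `σ(X, F)`. -/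
abbrev fTopology (F : Submodule ℂ (StrongDual ℂ X)) : TopologicalSpace X :=
  inferInstanceAs (TopologicalSpace (WeakBilin (pairing F)))

/-- The `X`-topology on `F`, that is, the weak topology `σ(F, X)`. -/
abbrev xTopology (F : Submodule ℂ (StrongDual ℂ X)) : TopologicalSpace F :=
  inferInstanceAs (TopologicalSpace (WeakBilin (pairing F).flip))

/-- `S` is relatively compact for the topology `t`: its `t`-closure is `t`-compact. -/
def IsRelCompact {E : Type*} (t : TopologicalSpace E) (S : Set E) : Prop :=
  @IsCompact E t (@closure E t S)

/-- `(X, F)` is a dual pair of Banach spaces, where `X` is a C*-algebra whose involution is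
`F`-continuous and whose multiplication is separately `F`-continuous. The space `F` carries the
norm of the dual of `X`. -/
structure IsDualPair (F : Submodule ℂ (StrongDual ℂ X)) : Prop where
  isClosed : IsClosed (F : Set (StrongDual ℂ X))
  norm_eq : ∀ x : X, IsLUB {r : ℝ | ∃ φ ∈ F, ‖φ‖ ≤ 1 ∧ r = ‖φ x‖} ‖x‖
  norm_functional_eq : ∀ φ ∈ F, IsLUB {r : ℝ | ∃ x : X, ‖x‖ ≤ 1 ∧ r = ‖φ x‖} ‖φ‖
  convexHull_relCompact : ∀ S : Set X,
    IsRelCompact (fTopology F) S → IsRelCompact (fTopology F) (convexHull ℝ S)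
  convexHull_relCompact_dual : ∀ S : Set F,
    IsRelCompact (xTopology F) S → IsRelCompact (xTopology F) (convexHull ℝ S)
  continuous_star : Continuous[fTopology F, fTopology F] (fun x : X => star x)
  continuous_mul_left : ∀ a : X, Continuous[fTopology F, fTopology F] (fun x : X => a * x)
  continuous_mul_right : ∀ a : X, Continuous[fTopology F, fTopology F] (fun x : X => x * a)

/-- `(X, G, α)` is an `F`-dynamical system: `(X, F)` is a dual pair, `G` acts on `X` by
`F`-continuous `*`-automorphisms, and all the functions `g ↦ φ (α_g x)`, `φ ∈ F`, `x ∈ X`, are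
continuous. -/
structure IsFDynamicalSystem {G : Type*} [Group G] [TopologicalSpace G]
    (F : Submodule ℂ (StrongDual ℂ X)) (α : G →* (X ≃⋆ₐ[ℂ] X)) : Prop where
  dualPair : IsDualPair F
  continuous_aut : ∀ g : G, Continuous[fTopology F, fTopology F] (fun x : X => α g x)
  continuous_orbit : ∀ φ ∈ F, ∀ x : X, Continuous (fun g : G => φ (α g x))

end DualPair

/-! ### Irreducible unitary representations and the dual of a compact group -/

section Representations

variable (G : Type*) [Group G] [TopologicalSpace G]

/-- A continuous irreducible unitary representation of `G` on the Hilbert space `ℂ^dim`, written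
with matrices (irreducible unitary representations of compact groups are finite dimensional). -/
structure IrrepMatrix where
  dim : ℕ
  toHom : G →* Matrix.unitaryGroup (Fin dim) ℂ
  continuous_toHom : Continuous toHom
  irreducible : Representation.IsIrreducible (k := ℂ) (G := G) (V := Fin dim → ℂ)
    ((Matrix.toLinAlgEquiv' (R := ℂ) (n := Fin dim) : _ →* _).comp
      ((Matrix.unitaryGroup (Fin dim) ℂ).subtype.comp toHom))

variable {G}

/-- The matrix `π_g`. -/
def IrrepMatrix.mat (π : IrrepMatrix G) (g : G) : Matrix (Fin π.dim) (Fin π.dim) ℂ :=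
  (π.toHom g : Matrix (Fin π.dim) (Fin π.dim) ℂ)

theorem IrrepMatrix.mat_star_mul (π : IrrepMatrix G) (g : G) : star (π.mat g) * π.mat g = 1 :=
  Unitary.star_mul_self_of_mem (π.toHom g).2

/-- Unitary equivalence of representations, by a unitary intertwiner `U`. -/
def UnitarilyEquivalent (π ρ : IrrepMatrix G) : Prop :=
  ∃ U : Matrix (Fin ρ.dim) (Fin π.dim) ℂ,
    U.conjTranspose * U = 1 ∧ U * U.conjTranspose = 1 ∧ ∀ g : G, U * π.mat g = ρ.mat g * U

theorem unitarilyEquivalent_equivalence :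
    Equivalence (UnitarilyEquivalent (G := G)) where
  refl π := ⟨1, by simp, by simp, fun g => by simp⟩
  symm := by
    rintro π ρ ⟨U, h1, h2, h3⟩
    refine ⟨U.conjTranspose, by simpa using h2, by simpa using h1, fun g => ?_⟩
    calc U.conjTranspose * ρ.mat g
        = U.conjTranspose * (ρ.mat g * U) * U.conjTranspose := by
          rw [Matrix.mul_assoc, Matrix.mul_assoc, h2, Matrix.mul_one]
      _ = π.mat g * U.conjTranspose := by
          rw [← h3, ← Matrix.mul_assoc, h1, Matrix.one_mul]
  trans := by
    rintro π ρ τ ⟨U, h1, h2, h3⟩ ⟨V, k1, k2, k3⟩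
    refine ⟨V * U, ?_, ?_, fun g => ?_⟩
    · rw [Matrix.conjTranspose_mul, Matrix.mul_assoc, ← Matrix.mul_assoc V.conjTranspose, k1,
        Matrix.one_mul, h1]
    · rw [Matrix.conjTranspose_mul, Matrix.mul_assoc, ← Matrix.mul_assoc U, h2, Matrix.one_mul, k2]
    · rw [Matrix.mul_assoc, h3, ← Matrix.mul_assoc, k3, Matrix.mul_assoc]

/-- The setoid of unitary equivalence. -/
def irrepSetoid (G : Type*) [Group G] [TopologicalSpace G] : Setoid (IrrepMatrix G) :=
  ⟨UnitarilyEquivalent, unitarilyEquivalent_equivalence⟩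

/-- The dual `Ĝ`: unitary equivalence classes of irreducible representations. -/
def GroupDual (G : Type*) [Group G] [TopologicalSpace G] : Type _ :=
  Quotient (irrepSetoid G)

/-- The fixed representative of a class in `Ĝ`. -/
def GroupDual.rep (π : GroupDual G) : IrrepMatrix G :=
  Quotient.out (s := irrepSetoid G) π

/-- The (normalized) character `χ_π(g) = d_π ∑ᵢ conj (π_ii(g))`. -/
def IrrepMatrix.chi (π : IrrepMatrix G) (g : G) : ℂ :=
  (π.dim : ℂ) * ∑ i, star (π.mat g i i)

end Representations

/-! ### Ideals, essential subsets, primeness -/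

section Ideals

variable {A : Type*} [NonUnitalRing A] [StarRing A] [Module ℂ A]

/-- `I` is a two-sided ideal (not necessarily closed) of the subalgebra `B` of `A`. -/
def IsTwoSidedIdealIn (B : NonUnitalStarSubalgebra ℂ A) (I : Submodule ℂ A) : Prop :=
  (∀ x ∈ I, x ∈ B) ∧ ∀ b ∈ B, ∀ x ∈ I, b * x ∈ I ∧ x * b ∈ I

/-- `I` is essential in `B`: the annihilator of `I` in `B` is trivial. (For self-adjoint `I`, and
for all two-sided ideals of C*-algebras, left and right annihilators vanish together.) -/
def IsEssentialIn (B : NonUnitalStarSubalgebra ℂ A) (I : Set A) : Prop :=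
  ∀ b ∈ B, (∀ x ∈ I, b * x = 0) → b = 0

/-- `B` is `F`-prime: every non-zero two-sided ideal of `B` is essential (that is, has trivial
annihilator). This condition does not involve `F`. -/
def IsFPrime (B : NonUnitalStarSubalgebra ℂ A) : Prop :=
  ∀ I : Submodule ℂ A, IsTwoSidedIdealIn B I → I ≠ ⊥ → IsEssentialIn B (I : Set A)

end Ideals

/-! ### The algebra `X ⊗ B(H_π)`, realized as the C*-algebra of matrices over `X` -/

section ScalarMatrices

variable {X : Type*} [NonUnitalCStarAlgebra X] {d : ℕ}

/-- `(1 ⊗ U) a` for a scalar matrix `U` and `a ∈ X ⊗ M_d(ℂ)`. -/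
def lmulScalar (U : Matrix (Fin d) (Fin d) ℂ) (a : CStarMatrix (Fin d) (Fin d) X) :
    CStarMatrix (Fin d) (Fin d) X :=
  CStarMatrix.ofMatrix fun i j => ∑ k, U i k • a k j

/-- `a (1 ⊗ U)` for a scalar matrix `U` and `a ∈ X ⊗ M_d(ℂ)`. -/
def rmulScalar (a : CStarMatrix (Fin d) (Fin d) X) (U : Matrix (Fin d) (Fin d) ℂ) :
    CStarMatrix (Fin d) (Fin d) X :=
  CStarMatrix.ofMatrix fun i j => ∑ k, U k j • a i k

/-- `β ⊗ ι` for an automorphism `β` of `X`: apply `β` to all the entries. -/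
def entrywise (β : X ≃⋆ₐ[ℂ] X) (a : CStarMatrix (Fin d) (Fin d) X) :
    CStarMatrix (Fin d) (Fin d) X :=
  CStarMatrix.ofMatrix fun i j => β (a i j)

variable (U V : Matrix (Fin d) (Fin d) ℂ) (a b : CStarMatrix (Fin d) (Fin d) X)
  (β : X ≃⋆ₐ[ℂ] X) (c : ℂ)

@[simp] theorem lmulScalar_apply (i j : Fin d) : lmulScalar U a i j = ∑ k, U i k • a k j := rfl

@[simp] theorem rmulScalar_apply (i j : Fin d) : rmulScalar a U i j = ∑ k, U k j • a i k := rfl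

@[simp] theorem entrywise_apply (i j : Fin d) : entrywise β a i j = β (a i j) := rfl

theorem lmulScalar_add : lmulScalar U (a + b) = lmulScalar U a + lmulScalar U b := by
  ext i j; simp [Finset.sum_add_distrib]

theorem rmulScalar_add : rmulScalar (a + b) U = rmulScalar a U + rmulScalar b U := by
  ext i j; simp [Finset.sum_add_distrib]

theorem entrywise_add : entrywise β (a + b) = entrywise β a + entrywise β b := by
  ext i j; simp

theorem lmulScalar_smul : lmulScalar U (c • a) = c • lmulScalar U a := by
  ext i j; simp [Finset.smul_sum, smul_comm c]

theorem rmulScalar_smul : rmulScalar (c • a) U = c • rmulScalar a U := by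
  ext i j; simp [Finset.smul_sum, smul_comm c]

theorem entrywise_smul : entrywise β (c • a) = c • entrywise β a := by
  ext i j; simp

@[simp] theorem lmulScalar_zero : lmulScalar U (0 : CStarMatrix (Fin d) (Fin d) X) = 0 := by
  ext i j; simp

@[simp] theorem rmulScalar_zero : rmulScalar (0 : CStarMatrix (Fin d) (Fin d) X) U = 0 := by
  ext i j; simp

@[simp] theorem entrywise_zero : entrywise β (0 : CStarMatrix (Fin d) (Fin d) X) = 0 := by
  ext i j; simp

theorem entrywise_mul : entrywise β (a * b) = entrywise β a * entrywise β b := by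
  ext i j; simp [CStarMatrix.mul_apply]

theorem entrywise_star : entrywise β (star a) = star (entrywise β a) := by
  ext i j; simp [CStarMatrix.star_apply, map_star]

theorem lmulScalar_mul : lmulScalar U (a * b) = lmulScalar U a * b := by
  ext i j
  simp only [lmulScalar_apply, CStarMatrix.mul_apply, Finset.smul_sum, Finset.sum_mul,
    smul_mul_assoc]
  exact Finset.sum_comm

theorem rmulScalar_mul : rmulScalar (a * b) U = a * rmulScalar b U := by
  ext i j
  simp only [rmulScalar_apply, CStarMatrix.mul_apply, Finset.smul_sum, Finset.mul_sum,
    mul_smul_comm]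
  exact Finset.sum_comm

theorem rmulScalar_mul_eq : rmulScalar a U * b = a * lmulScalar U b := by
  ext i j
  simp only [rmulScalar_apply, lmulScalar_apply, CStarMatrix.mul_apply, Finset.mul_sum,
    Finset.sum_mul, mul_smul_comm, smul_mul_assoc]
  exact Finset.sum_comm

theorem lmulScalar_lmulScalar : lmulScalar U (lmulScalar V a) = lmulScalar (U * V) a := by
  ext i j
  simp only [lmulScalar_apply, Matrix.mul_apply, Finset.smul_sum, Finset.sum_smul, smul_smul]
  exact Finset.sum_comm

theorem lmulScalar_one : lmulScalar 1 a = a := by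
  ext i j
  simp [Matrix.one_apply, ite_smul]

theorem lmulScalar_rmulScalar : lmulScalar U (rmulScalar a V) = rmulScalar (lmulScalar U a) V := by
  ext i j
  simp only [lmulScalar_apply, rmulScalar_apply, Finset.smul_sum, smul_smul, mul_comm]
  exact Finset.sum_comm

theorem star_lmulScalar : star (lmulScalar U a) = rmulScalar (star a) (star U) := by
  ext i j
  simp [CStarMatrix.star_apply, Matrix.star_apply]

theorem star_rmulScalar : star (rmulScalar a U) = lmulScalar (star U) (star a) := by
  ext i j
  simp [CStarMatrix.star_apply, Matrix.star_apply]

end ScalarMatrices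

/-! ### Spectral subspaces, fixed point algebras and spectra -/

section Spectra

variable {X : Type*} [NonUnitalCStarAlgebra X] {G : Type*} [Group G]

/-- `y` is the weak integral `∫ f(g) dg` with respect to the normalized Haar measure of `G`:
`φ y = ∫ φ (f g) dg` for every `φ ∈ F`. -/
def IsWeakIntegral [TopologicalSpace G] [IsTopologicalGroup G] [CompactSpace G]
    [MeasurableSpace G] [BorelSpace G] (F : Submodule ℂ (StrongDual ℂ X)) (f : G → X) (y : X) :
    Prop :=
  ∀ φ ∈ F, φ y = ∫ g, φ (f g) ∂(MeasureTheory.Measure.haarMeasure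
    (⊤ : TopologicalSpace.PositiveCompacts G))

/-- The spectral subspace `X₁(π) = {x : P_α(π)(x) = x}`, where `P_α(π)(x)` is the weak integral
`∫ χ_π(g) α_g(x) dg`. -/
def spectralSubspaceOne [TopologicalSpace G] [IsTopologicalGroup G] [CompactSpace G]
    [MeasurableSpace G] [BorelSpace G] (F : Submodule ℂ (StrongDual ℂ X))
    (α : G →* (X ≃⋆ₐ[ℂ] X)) (π : IrrepMatrix G) : Set X :=
  {x | IsWeakIntegral F (fun g => π.chi g • α g x) x}

variable [TopologicalSpace G]

/-- The action `α ⊗ ad π` on `X ⊗ B(H_π)`: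
`(α_g ⊗ ad π_g)(a) = (1 ⊗ π_g) [α_g(a_ij)] (1 ⊗ π_g*)`. -/
def adAction (α : G →* (X ≃⋆ₐ[ℂ] X)) (π : IrrepMatrix G) (g : G)
    (a : CStarMatrix (Fin π.dim) (Fin π.dim) X) : CStarMatrix (Fin π.dim) (Fin π.dim) X :=
  lmulScalar (π.mat g) (rmulScalar (entrywise (α g) a) (star (π.mat g)))

/-- The fixed point algebra `(Y ⊗ B(H_π))^{α ⊗ ad π}` for a `*`-subalgebra `Y` of `X`, as a
`*`-subalgebra of `X ⊗ B(H_π)`. -/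
def fixedAlgebra (α : G →* (X ≃⋆ₐ[ℂ] X)) (π : IrrepMatrix G) (Y : NonUnitalStarSubalgebra ℂ X) :
    NonUnitalStarSubalgebra ℂ (CStarMatrix (Fin π.dim) (Fin π.dim) X) where
  carrier := {a | (∀ i j, a i j ∈ Y) ∧ ∀ g : G, adAction α π g a = a}
  add_mem' := by
    rintro a b ⟨ha, ha'⟩ ⟨hb, hb'⟩
    refine ⟨fun i j => add_mem (ha i j) (hb i j), fun g => ?_⟩
    have h1 := ha' g
    have h2 := hb' g
    simp only [adAction] at h1 h2 ⊢
    rw [entrywise_add, rmulScalar_add, lmulScalar_add, h1, h2]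
  zero_mem' := ⟨fun i j => zero_mem Y, fun g => by simp [adAction]⟩
  mul_mem' := by
    rintro a b ⟨ha, ha'⟩ ⟨hb, hb'⟩
    refine ⟨fun i j => ?_, fun g => ?_⟩
    · rw [CStarMatrix.mul_apply]
      exact sum_mem fun k _ => mul_mem (ha i k) (hb k j)
    · have h1 := ha' g
      have h2 := hb' g
      simp only [adAction] at h1 h2 ⊢
      conv_rhs => rw [← h1, ← h2]
      rw [← lmulScalar_mul, rmulScalar_mul_eq, lmulScalar_lmulScalar, π.mat_star_mul,
        lmulScalar_one, entrywise_mul, rmulScalar_mul]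
  smul_mem' := by
    rintro c a ⟨ha, ha'⟩
    refine ⟨fun i j => SMulMemClass.smul_mem c (ha i j), fun g => ?_⟩
    have h1 := ha' g
    simp only [adAction] at h1 ⊢
    rw [entrywise_smul, rmulScalar_smul, lmulScalar_smul, h1]
  star_mem' := by
    rintro a ⟨ha, ha'⟩
    refine ⟨fun i j => ?_, fun g => ?_⟩
    · rw [CStarMatrix.star_apply]
      exact star_mem (ha j i)
    · have h1 := ha' g
      simp only [adAction] at h1 ⊢
      conv_rhs => rw [← h1]
      rw [star_lmulScalar, star_rmulScalar, star_star, entrywise_star, lmulScalar_rmulScalar]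

/-- The spectral subspace `Y₂(π) = {a ∈ Y ⊗ B(H_π) : (α_g ⊗ ι)(a) = a (1 ⊗ π_g) for all g}`. -/
def spectralSubspaceTwo (α : G →* (X ≃⋆ₐ[ℂ] X)) (π : IrrepMatrix G)
    (Y : NonUnitalStarSubalgebra ℂ X) : Set (CStarMatrix (Fin π.dim) (Fin π.dim) X) :=
  {a | (∀ i j, a i j ∈ Y) ∧ ∀ g : G, entrywise (α g) a = rmulScalar a (π.mat g)}

/-- The linear span `Y₂(π)* Y₂(π)` of the products `a* b`, `a, b ∈ Y₂(π)`. -/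
def spectralIdeal (α : G →* (X ≃⋆ₐ[ℂ] X)) (π : IrrepMatrix G)
    (Y : NonUnitalStarSubalgebra ℂ X) :
    Submodule ℂ (CStarMatrix (Fin π.dim) (Fin π.dim) X) :=
  Submodule.span ℂ
    {c | ∃ a ∈ spectralSubspaceTwo α π Y, ∃ b ∈ spectralSubspaceTwo α π Y, c = star a * b}

/-- The `F ⊗ B(H)*`-topology on `X ⊗ M_d(ℂ)`, that is, entrywise `F`-convergence. -/
@[reducible]
def matrixFTopology (F : Submodule ℂ (StrongDual ℂ X)) (d : ℕ) :
    TopologicalSpace (CStarMatrix (Fin d) (Fin d) X) :=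
  @Pi.topologicalSpace (Fin d) (fun _ => Fin d → X)
    (fun _ => @Pi.topologicalSpace (Fin d) (fun _ => X) (fun _ => fTopology F))

/-- The Arveson type spectrum `sp(α) = {π : X₁(π) ≠ {0}}`. -/
def spec [IsTopologicalGroup G] [CompactSpace G] [MeasurableSpace G] [BorelSpace G]
    (F : Submodule ℂ (StrongDual ℂ X)) (α : G →* (X ≃⋆ₐ[ℂ] X)) : Set (GroupDual G) :=
  {π | spectralSubspaceOne F α π.rep ≠ {0}}

/-- The spectrum `sp_F(α|_Y)`: those `π` for which the `F`-closure of `Y₂(π)* Y₂(π)` is essential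
in `(Y ⊗ B(H_π))^{α ⊗ ad π}`. It is used for `α`-invariant `F`-closed `Y`, so that closures in `Y`
and in `X` agree. -/
def specF (F : Submodule ℂ (StrongDual ℂ X)) (α : G →* (X ≃⋆ₐ[ℂ] X))
    (Y : NonUnitalStarSubalgebra ℂ X) : Set (GroupDual G) :=
  {π | IsEssentialIn (fixedAlgebra α π.rep Y)
    (@closure _ (matrixFTopology F π.rep.dim)
      (spectralIdeal α π.rep Y : Set (CStarMatrix (Fin π.rep.dim) (Fin π.rep.dim) X)))}

/-- `Y` belongs to `H_σ^α(X)`: it is a non-zero `α`-invariant `F`-closed hereditary C*-subalgebra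
of `X`. (An `F`-closed subspace is norm closed.) -/
structure IsInvariantHereditary [PartialOrder X] (F : Submodule ℂ (StrongDual ℂ X))
    (α : G →* (X ≃⋆ₐ[ℂ] X)) (Y : NonUnitalStarSubalgebra ℂ X) : Prop where
  nonzero : ∃ y ∈ Y, y ≠ 0
  invariant : ∀ g : G, ∀ y ∈ Y, α g y ∈ Y
  isClosed : @IsClosed X (fTopology F) (Y : Set X)
  hereditary : ∀ x y : X, 0 ≤ x → x ≤ y → y ∈ Y → x ∈ Y

/-- The Connes spectrum `Γ_F(α) = ⋂ {sp_F(α|_Y) : Y ∈ H_σ^α(X)}`. -/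
def connesSpectrum [PartialOrder X] (F : Submodule ℂ (StrongDual ℂ X))
    (α : G →* (X ≃⋆ₐ[ℂ] X)) : Set (GroupDual G) :=
  {π | ∀ Y : NonUnitalStarSubalgebra ℂ X, IsInvariantHereditary F α Y → π ∈ specF F α Y}

/-- `X` is `α`-prime: every non-zero `α`-invariant two-sided ideal of `X` is essential. -/
def IsActionPrime (α : G →* (X ≃⋆ₐ[ℂ] X)) : Prop :=
  ∀ I : Submodule ℂ X, IsTwoSidedIdealIn ⊤ I → (∀ g : G, ∀ x ∈ I, α g x ∈ I) → I ≠ ⊥ →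
    IsEssentialIn ⊤ (I : Set X)

end Spectra

end CompactAction

end

open CompactAction

noncomputable section

namespace CompactAction

open MeasureTheory

/-! ### Matrix representations -/

section MatrixRepresentations

variable {G : Type*} [Group G] [TopologicalSpace G]

/-! Both conditions are compared with primeness of the fixed point algebra $X^\alpha$ in elementwise
form, `IsFixedPrime`: $pX^\alpha q=0$ with $p\ne0$ forces $q=0$. Elements $a,b$ of $X_2(\pi)$ link
the levels. The entries of $ab^*$ lie in $X^\alpha$, while $a^*zb$ lies in $(X\otimes
B(H_\pi))^{\alpha\otimes ad\pi}$ for every matrix $z$ over $X^\alpha$.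

From (i), the trivial representation gives primeness of $X^\alpha$ (`isFixedPrime_of_isFPrime`).
This yields $\alpha$-primeness, because nonzero invariant annihilators contain nonzero fixed
elements (`isActionPrime_of_isFixedPrime`). It also gives $sp(\alpha)\subseteq\Gamma_{\mathcal
F}(\alpha)$: compressing $X_2(\pi)$ between a fixed $p\in Y$ and a matrix over $Y$ lands in
$Y_2(\pi)$, since $YXY\subseteq Y$ (`spec_subset_connesSpectrum`). The reverse inclusion always
holds.

From (ii), suppose $pX^\alpha q=0$. The elements annihilated by $pX^\alpha$, together with their
adjoints, form a hereditary algebra $Y$; the Connes spectrum condition for $Y$ forces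
$p\,a_{ij}\,q=0$ for all spectral elements $a$. These entries determine every functional in
$\mathcal F$, so $pXq=0$, against $\alpha$-primeness (`isFixedPrime_of_spec_subset`). Primeness of
$X^\alpha$ then passes to each fixed point algebra with $\pi\in\Gamma_{\mathcal F}(\alpha)$ through
$X_2(\pi)$ (`isFPrime_of_isFixedPrime`).

The analytic input is that spectral components separate: Peter–Weyl completeness
(`eq_zero_of_forall_integral_mul_mat_eq_zero`) combined with weak integrals, which exist by
condition (d). -/

theorem IrrepMatrix.mat_mul (π : IrrepMatrix G) (g h : G) :
    π.mat (g * h) = π.mat g * π.mat h := by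
  simp [IrrepMatrix.mat]

theorem IrrepMatrix.mat_mul_star (π : IrrepMatrix G) (g : G) : π.mat g * star (π.mat g) = 1 :=
  Unitary.mul_star_self_of_mem (π.toHom g).2

theorem IrrepMatrix.mat_inv (π : IrrepMatrix G) (g : G) : π.mat g⁻¹ = star (π.mat g) := by
  simp [IrrepMatrix.mat]

theorem IrrepMatrix.mat_inv_apply (π : IrrepMatrix G) (g : G) (i j : Fin π.dim) :
    π.mat g⁻¹ i j = star (π.mat g j i) := by
  rw [π.mat_inv, Matrix.star_apply]

theorem IrrepMatrix.continuous_mat_apply (π : IrrepMatrix G) (i j : Fin π.dim) :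
    Continuous fun g => π.mat g i j :=
  (continuous_subtype_val.comp π.continuous_toHom).matrix_elem i j

theorem IrrepMatrix.continuous_star_mat_apply (π : IrrepMatrix G) (i j : Fin π.dim) :
    Continuous fun g => star (π.mat g i j) :=
  continuous_star.comp (π.continuous_mat_apply i j)

theorem IrrepMatrix.dim_pos (π : IrrepMatrix G) : 0 < π.dim := by
  rw [Nat.pos_iff_ne_zero]
  intro h
  refine π.irreducible.toNontrivial.exists_pair_ne.elim fun S hS => hS.elim fun T hST => hST ?_
  apply Subrepresentation.toSubmodule_injective
  have : IsEmpty (Fin π.dim) := by rw [h]; infer_instance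
  exact Subsingleton.elim _ _

/-- **Schur's lemma** for irreducible matrix representations. -/
theorem IrrepMatrix.exists_eq_smul_one_of_commute (π : IrrepMatrix G)
    (A : Matrix (Fin π.dim) (Fin π.dim) ℂ) (hA : ∀ g, A * π.mat g = π.mat g * A) :
    ∃ c : ℂ, A = c • (1 : Matrix (Fin π.dim) (Fin π.dim) ℂ) := by
  have := π.irreducible
  set ρ : Representation ℂ G (Fin π.dim → ℂ) :=
    ((Matrix.toLinAlgEquiv' (R := ℂ) (n := Fin π.dim) : _ →* _).comp
      ((Matrix.unitaryGroup (Fin π.dim) ℂ).subtype.comp π.toHom)) with hρ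
  have hρg : ∀ g v, ρ g v = (π.mat g).mulVec v := fun g v => rfl
  let T : Representation.IntertwiningMap ρ ρ :=
    LinearMap.intertwiningMap_of_isIntertwiningMap ρ ρ (Matrix.toLin' A) (fun g v => by
      rw [hρg, hρg, Matrix.toLin'_apply, Matrix.toLin'_apply, Matrix.mulVec_mulVec,
        Matrix.mulVec_mulVec, hA])
  obtain ⟨c, hc⟩ :=
    Representation.IsIrreducible.algebraMap_intertwiningMap_bijective_of_isAlgClosed.2 T
  refine ⟨c, ?_⟩
  have h : Matrix.toLin' A = c • LinearMap.id := by
    have := congrArg Representation.IntertwiningMap.toLinearMap hc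
    rw [← show T.toLinearMap = Matrix.toLin' A from rfl, ← this]
    rfl
  apply Matrix.toLin'.injective
  rw [h, map_smul, Matrix.toLin'_one]

/-- A finite-dimensional non-zero invariant subspace of a strongly continuous isometric
representation contains an orthonormal family that transforms according to an irreducible matrix
representation. -/
theorem exists_irrepMatrix_of_invariant {H : Type*} [NormedAddCommGroup H] [InnerProductSpace ℂ H]
    (ρ : Representation ℂ G H) (hinner : ∀ g u v, inner ℂ (ρ g u) (ρ g v) = inner ℂ u v)
    (hcont : ∀ u, Continuous fun g => ρ g u) (E : Submodule ℂ H) [FiniteDimensional ℂ E]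
    (hE : E ≠ ⊥) (hinv : ∀ g, ∀ u ∈ E, ρ g u ∈ E) :
    ∃ (π : IrrepMatrix G) (e : Fin π.dim → H), Orthonormal ℂ e ∧ (∀ i, e i ∈ E) ∧
      ∀ g i, ρ g (e i) = ∑ j, π.mat g j i • e j := by
  classical
  -- A nonzero invariant subspace of least dimension is irreducible, so no decomposition theorem is
  -- needed.
  let P : ℕ → Prop := fun n => ∃ W : Submodule ℂ H, W ≤ E ∧ W ≠ ⊥ ∧
    (∀ g, ∀ u ∈ W, ρ g u ∈ W) ∧ Module.finrank ℂ W = n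
  have hP : ∃ n, P n := ⟨_, E, le_rfl, hE, hinv, rfl⟩
  obtain ⟨W, hWE, hW0, hWinv, hWn⟩ := Nat.find_spec hP
  have hmin : ∀ V : Submodule ℂ H, V ≤ W → V ≠ ⊥ → (∀ g, ∀ u ∈ V, ρ g u ∈ V) → V = W := by
    intro V hVW hV0 hVinv
    have := Submodule.finiteDimensional_of_le hWE
    apply Submodule.eq_of_le_of_finrank_le hVW
    rw [hWn]
    exact Nat.find_min' hP ⟨V, hVW.trans hWE, hV0, hVinv, rfl⟩
  have hfd : FiniteDimensional ℂ W := Submodule.finiteDimensional_of_le hWE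
  let b := stdOrthonormalBasis ℂ W
  let d := Module.finrank ℂ W
  let e : Fin d → H := fun i => (b i : H)
  have he : Orthonormal ℂ e := b.orthonormal.comp_linearIsometry W.subtypeₗᵢ
  have hexp : ∀ u ∈ W, u = ∑ j, inner ℂ (e j) u • e j := by
    intro u hu
    have := congrArg Subtype.val (b.sum_repr' ⟨u, hu⟩)
    simpa [e] using this.symm
  have heW : ∀ i, e i ∈ W := fun i => (b i).2
  let M : G → Matrix (Fin d) (Fin d) ℂ := fun g => Matrix.of fun j i => inner ℂ (e j) (ρ g (e i))
  have hM : ∀ g i, ρ g (e i) = ∑ j, M g j i • e j := fun g i => hexp _ (hWinv g _ (heW i))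
  have hone : M 1 = 1 := by
    ext i j
    simp only [M, Matrix.of_apply, map_one, Module.End.one_apply]
    rw [orthonormal_iff_ite.1 he, Matrix.one_apply]
  have hmul : ∀ g h, M (g * h) = M g * M h := by
    intro g h
    ext i j
    rw [Matrix.mul_apply]
    simp only [M, Matrix.of_apply, map_mul, Module.End.mul_apply]
    conv_lhs => rw [hM h j]
    simp only [map_sum, map_smul, inner_sum, inner_smul_right, M, Matrix.of_apply]
    exact Finset.sum_congr rfl fun k _ => mul_comm _ _
  have hunit : ∀ g, star (M g) * M g = 1 := by
    intro g
    have hst : star (M g) = M g⁻¹ := by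
      ext i j
      simp only [Matrix.star_apply, M, Matrix.of_apply]
      rw [← hinner g (e i), ← Module.End.mul_apply, ← map_mul, mul_inv_cancel, map_one,
        Module.End.one_apply]
      exact inner_conj_symm _ _
    rw [hst, ← hmul, inv_mul_cancel, hone]
  let τ : G →* Matrix.unitaryGroup (Fin d) ℂ :=
    { toFun := fun g => ⟨M g, Matrix.mem_unitaryGroup_iff'.2 (hunit g)⟩
      map_one' := Subtype.ext hone
      map_mul' := fun g h => Subtype.ext (hmul g h) }
  have hτ : Continuous τ := by
    refine Continuous.subtype_mk (continuous_matrix fun i j => ?_) _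
    exact continuous_const.inner (hcont _)
  set σ : Representation ℂ G (Fin d → ℂ) :=
    ((Matrix.toLinAlgEquiv' (R := ℂ) (n := Fin d) : _ →* _).comp
      ((Matrix.unitaryGroup (Fin d) ℂ).subtype.comp τ)) with hσ
  have hσg : ∀ g v, σ g v = (M g).mulVec v := fun g v => rfl
  -- The coordinate map is an injective intertwiner into `W`; it carries subrepresentations of the
  -- matrix model to invariant subspaces of `W`, where minimality applies.
  let Φ : (Fin d → ℂ) →ₗ[ℂ] H := Fintype.linearCombination ℂ e
  have hΦ : ∀ v, Φ v = ∑ i, v i • e i := fun v => Fintype.linearCombination_apply ℂ e v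
  have hΦσ : ∀ g v, Φ (σ g v) = ρ g (Φ v) := by
    intro g v
    rw [hΦ, hΦ, map_sum]
    simp only [map_smul, hM, Finset.smul_sum, smul_smul, hσg, Matrix.mulVec, dotProduct,
      Finset.sum_smul]
    rw [Finset.sum_comm]
    simp only [mul_comm]
  have hΦinj : Function.Injective Φ := by
    rw [← LinearMap.ker_eq_bot, LinearMap.ker_eq_bot']
    intro v hv
    exact funext (Fintype.linearIndependent_iff.1 he.linearIndependent v ((hΦ v).symm.trans hv))
  have hΦW : ∀ v, Φ v ∈ W := fun v => by
    rw [hΦ]; exact sum_mem fun i _ => W.smul_mem _ (heW i)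
  have hirr : Representation.IsIrreducible σ := by
    refine @IsSimpleOrder.mk _ _ _ ⟨⊥, ⊤, fun h => hW0 ?_⟩ fun S => ?_
    · have h' : (⊥ : Submodule ℂ (Fin d → ℂ)) = ⊤ :=
        congrArg Subrepresentation.toSubmodule h
      rw [Submodule.eq_bot_iff]
      intro u hu
      rw [hexp u hu, ← hΦ (fun j => inner ℂ (e j) u)]
      have : (fun j => inner ℂ (e j) u) ∈ (⊥ : Submodule ℂ (Fin d → ℂ)) := by
        rw [h']; trivial
      rw [(Submodule.mem_bot ℂ).1 this, map_zero]
    · by_cases hS : S.toSubmodule = ⊥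
      · left
        exact Subrepresentation.toSubmodule_injective hS
      · right
        apply Subrepresentation.toSubmodule_injective
        have hV : S.toSubmodule.map Φ = W := by
          apply hmin
          · rintro _ ⟨v, _, rfl⟩
            exact hΦW v
          · rwa [Ne, ← LinearMap.le_ker_iff_map, LinearMap.ker_eq_bot.2 hΦinj, le_bot_iff]
          · rintro g _ ⟨v, hv, rfl⟩
            exact ⟨σ g v, S.apply_mem_toSubmodule g hv, hΦσ g v⟩
        change S.toSubmodule = ⊤
        rw [eq_top_iff]
        intro v _
        have : Φ v ∈ S.toSubmodule.map Φ := by rw [hV]; exact hΦW v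
        obtain ⟨w, hw, hwv⟩ := this
        rwa [← hΦinj hwv]
  exact ⟨⟨d, τ, hτ, hirr⟩, e, he, fun i => hWE (heW i), hM⟩

end MatrixRepresentations

/-! ### Orthogonality relations and completeness of matrix coefficients -/

section HarmonicAnalysis

/-- The integral operator `u ↦ (x ↦ ⟪k x, u⟫)` of a continuous family `k` of vectors. -/
def innerKernelOperator {K H : Type*} [TopologicalSpace K] [CompactSpace K]
    [NormedAddCommGroup H] [InnerProductSpace ℂ H] (k : C(K, H)) : H →L[ℂ] C(K, ℂ) :=
  LinearMap.mkContinuous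
    { toFun := fun u => ⟨fun x => inner ℂ (k x) u, k.continuous.inner continuous_const⟩
      map_add' := fun u v => by ext x; simp
      map_smul' := fun c u => by ext x; simp } ‖k‖ (fun u => by
    rw [ContinuousMap.norm_le _ (by positivity)]
    intro x
    exact (norm_inner_le_norm _ _).trans
      (mul_le_mul_of_nonneg_right (k.norm_coe_le_norm x) (norm_nonneg u)))

@[simp]
theorem innerKernelOperator_apply {K H : Type*} [TopologicalSpace K] [CompactSpace K]
    [NormedAddCommGroup H] [InnerProductSpace ℂ H] (k : C(K, H)) (u : H) (x : K) :
    innerKernelOperator k u x = inner ℂ (k x) u := rfl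

/-- Arzelà–Ascoli: by Cauchy–Schwarz the images of unit vectors are bounded by `‖k‖` and inherit
their equicontinuity from `k`. The passage to bounded continuous functions is an isometry. -/
theorem isCompactOperator_innerKernelOperator {K H : Type*} [TopologicalSpace K] [CompactSpace K]
    [NormedAddCommGroup H] [InnerProductSpace ℂ H] (k : C(K, H)) :
    IsCompactOperator (innerKernelOperator k) := by
  let ι := ContinuousMap.linearIsometryBoundedOfCompact K ℂ ℂ
  let j : C(K, ℂ) →L[ℂ] BoundedContinuousFunction K ℂ :=
    ι.toContinuousLinearEquiv.toContinuousLinearMap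
  let j' : BoundedContinuousFunction K ℂ →L[ℂ] C(K, ℂ) :=
    ι.symm.toContinuousLinearEquiv.toContinuousLinearMap
  suffices h : IsCompactOperator (j ∘L innerKernelOperator k) from h.clm_comp j'
  refine (isCompactOperator_iff_isCompact_closure_image_closedBall
    (j ∘L innerKernelOperator k : H →ₗ[ℂ] BoundedContinuousFunction K ℂ) zero_lt_one).2 ?_
  refine BoundedContinuousFunction.arzela_ascoli (Metric.closedBall (0 : ℂ) ‖k‖)
    (isCompact_closedBall _ _) _ ?_ ?_
  · rintro _ x ⟨u, hu, rfl⟩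
    rw [mem_closedBall_zero_iff] at hu ⊢
    calc ‖inner ℂ (k x) u‖ ≤ ‖k x‖ * ‖u‖ := norm_inner_le_norm _ _
      _ ≤ ‖k‖ * 1 := by gcongr; exact k.norm_coe_le_norm x
      _ = ‖k‖ := mul_one _
  · intro x₀
    rw [Metric.equicontinuousAt_iff_right]
    intro ε hε
    filter_upwards [Metric.continuousAt_iff'.1 (k.continuous.continuousAt (x := x₀)) ε hε]
      with x hx
    rintro ⟨_, u, hu, rfl⟩
    rw [mem_closedBall_zero_iff] at hu
    change dist (inner ℂ (k x₀) u) (inner ℂ (k x) u) < ε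
    rw [dist_comm, dist_eq_norm, ← inner_sub_left]
    calc ‖inner ℂ (k x - k x₀) u‖ ≤ ‖k x - k x₀‖ * ‖u‖ := norm_inner_le_norm _ _
      _ ≤ ‖k x - k x₀‖ * 1 := by gcongr
      _ < ε := by rwa [mul_one, ← dist_eq_norm]

variable {G : Type*} [Group G] [TopologicalSpace G] [IsTopologicalGroup G] [CompactSpace G]
  [MeasurableSpace G] [BorelSpace G]

variable (G) in
/-- The normalized Haar measure of a compact group. -/
abbrev normalizedHaar : Measure G :=
  MeasureTheory.Measure.haarMeasure (⊤ : TopologicalSpace.PositiveCompacts G)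

instance : IsProbabilityMeasure (normalizedHaar G) :=
  ⟨by simpa using Measure.haarMeasure_self (K₀ := (⊤ : TopologicalSpace.PositiveCompacts G))⟩

theorem integrable_normalizedHaar {f : G → ℂ} (hf : Continuous f) :
    Integrable f (normalizedHaar G) :=
  hf.integrable_of_hasCompactSupport (HasCompactSupport.of_compactSpace f)

/-- The **Schur orthogonality relations** for the coefficients of one representation. -/
theorem IrrepMatrix.integral_mat_mul_star_mat (π : IrrepMatrix G) (i j k l : Fin π.dim) :
    (π.dim : ℂ) * ∫ g, π.mat g i k * star (π.mat g j l) ∂(normalizedHaar G) =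
      if i = j ∧ k = l then 1 else 0 := by
  let A : Matrix (Fin π.dim) (Fin π.dim) ℂ :=
    Matrix.of fun i j => ∫ g, π.mat g i k * star (π.mat g j l) ∂(normalizedHaar G)
  have hint : ∀ a b c e, Integrable (fun g => π.mat g a b * star (π.mat g c e))
      (normalizedHaar G) := fun a b c e =>
    integrable_normalizedHaar ((π.continuous_mat_apply a b).mul (π.continuous_star_mat_apply c e))
  -- Invariance of Haar measure under $g\mapsto hg$. Schur's lemma then makes `A` a scalar $c$, and
  -- the trace, computed by unitarity, gives $d_\pi c=\delta_{kl}$.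
  have hA : ∀ h, π.mat h * A * star (π.mat h) = A := by
    intro h
    ext a b
    simp only [Matrix.mul_apply, A, Matrix.of_apply, Matrix.star_apply]
    conv_rhs => rw [← integral_mul_left_eq_self _ h]
    simp only [π.mat_mul, Matrix.mul_apply, star_sum, star_mul', Finset.sum_mul, Finset.mul_sum]
    have hint' : ∀ c e, Integrable (fun g => π.mat h a e * π.mat g e k *
        (star (π.mat h b c) * star (π.mat g c l))) (normalizedHaar G) := fun c e =>
      integrable_normalizedHaar ((continuous_const.mul (π.continuous_mat_apply e k)).mul
        (continuous_const.mul (π.continuous_star_mat_apply c l)))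
    rw [integral_finsetSum _ fun c _ => integrable_finsetSum _ fun e _ => hint' c e]
    refine Finset.sum_congr rfl fun c _ => ?_
    rw [integral_finsetSum _ fun e _ => hint' c e]
    refine Finset.sum_congr rfl fun e _ => ?_
    rw [← integral_const_mul, ← integral_mul_const]
    congr 1
    ext g
    ring
  have hcomm : ∀ h, A * π.mat h = π.mat h * A := by
    intro h
    conv_lhs => rw [← hA h]
    rw [Matrix.mul_assoc, π.mat_star_mul, Matrix.mul_one]
  obtain ⟨c, hc⟩ := π.exists_eq_smul_one_of_commute A hcomm
  have htr : A.trace = if k = l then 1 else 0 := by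
    simp only [Matrix.trace, Matrix.diag_apply, A, Matrix.of_apply]
    rw [← integral_finsetSum _ fun a _ => hint a k a l]
    have : ∀ g, ∑ a, π.mat g a k * star (π.mat g a l) = if k = l then 1 else 0 := by
      intro g
      have := congrFun (congrFun (π.mat_star_mul g) l) k
      simp only [Matrix.mul_apply, Matrix.star_apply, Matrix.one_apply] at this
      simp only [mul_comm (π.mat g _ k), this, eq_comm]
    simp only [this, integral_const, probReal_univ, one_smul]
  have hdc : (π.dim : ℂ) * c = if k = l then 1 else 0 := by
    rw [← htr, hc, Matrix.trace_smul, Matrix.trace_one, Fintype.card_fin, smul_eq_mul, mul_comm]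
  have hAij : ∫ g, π.mat g i k * star (π.mat g j l) ∂(normalizedHaar G) =
      (c • (1 : Matrix (Fin π.dim) (Fin π.dim) ℂ)) i j := by rw [← hc]; rfl
  rw [hAij, Matrix.smul_apply, Matrix.one_apply, smul_eq_mul, ← mul_assoc, hdc]
  by_cases h1 : i = j <;> by_cases h2 : k = l <;> simp [h1, h2]

variable (G) in
/-- The left regular representation on `L²(G)`. -/
def leftRegular : Representation ℂ G (Lp ℂ 2 (normalizedHaar G)) where
  toFun g :=
    -- The domain action is precomposition, so the inverse is what yields a left action.
    { toFun := fun u => DomMulAct.mk g⁻¹ • u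
      map_add' := fun u v => smul_add _ u v
      map_smul' := fun c u => smul_comm _ c u }
  map_one' := by ext1 u; simp
  map_mul' g h := by
    ext1 u
    simp [mul_smul]

theorem leftRegular_inner (g : G) (u v : Lp ℂ 2 (normalizedHaar G)) :
    inner ℂ (leftRegular G g u) (leftRegular G g v) = inner ℂ u v :=
  LinearIsometry.inner_map_map (⟨leftRegular G g, fun _ => DomMulAct.norm_smul_Lp _ _⟩ :
    Lp ℂ 2 (normalizedHaar G) →ₗᵢ[ℂ] Lp ℂ 2 (normalizedHaar G)) u v

theorem continuous_leftRegular [T2Space G] (u : Lp ℂ 2 (normalizedHaar G)) :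
    Continuous fun g => leftRegular G g u := by
  have : Fact ((2 : ENNReal) ≠ ⊤) := ⟨by simp⟩
  exact ((DomMulAct.continuous_mk.comp continuous_inv).smul continuous_const)

theorem leftRegular_toLp (g : G) (c : C(G, ℂ)) :
    leftRegular G g (ContinuousMap.toLp 2 (normalizedHaar G) ℂ c) =
      ContinuousMap.toLp 2 (normalizedHaar G) ℂ (c.comp ⟨fun x => g⁻¹ * x, by fun_prop⟩) :=
  rfl

/-- **Completeness of matrix coefficients** (Peter–Weyl): a continuous function that is orthogonal
to the coefficients of all irreducible representations vanishes. -/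
theorem eq_zero_of_forall_integral_mul_mat_eq_zero [T2Space G] (f : C(G, ℂ))
    (hf : ∀ (π : IrrepMatrix G) (i j : Fin π.dim),
      ∫ g, f g * π.mat g i j ∂(normalizedHaar G) = 0) : f = 0 := by
  let H := Lp ℂ 2 (normalizedHaar G)
  let ι : C(G, ℂ) →L[ℂ] H := ContinuousMap.toLp 2 (normalizedHaar G) ℂ
  -- The conjugate cancels the conjugate-linearity of the inner product in its first slot: `A₁ u`
  -- becomes the convolution $x\mapsto\int u(y)f(y^{-1}x)\,dy$, which commutes with left
  -- translations.
  let κ : C(G, C(G, ℂ)) := ContinuousMap.curry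
    ⟨fun p : G × G => star (f (p.2⁻¹ * p.1)), by fun_prop⟩
  have hκ : ∀ x y, κ x y = star (f (y⁻¹ * x)) := fun x y => rfl
  let k : C(G, H) := ⟨fun x => ι (κ x), ι.continuous.comp κ.continuous⟩
  have hk : ∀ h x, leftRegular G h (k x) = k (h * x) := by
    intro h x
    refine (leftRegular_toLp h (κ x)).trans (congrArg ι ?_)
    ext y
    simp [hκ, mul_assoc]
  let A₁ : H →L[ℂ] C(G, ℂ) := innerKernelOperator k
  let A : H →L[ℂ] H := ι ∘L A₁
  have hA₁ : ∀ h u x, A₁ (leftRegular G h u) x = A₁ u (h⁻¹ * x) := by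
    intro h u x
    simp only [A₁, innerKernelOperator_apply]
    rw [← leftRegular_inner h (k (h⁻¹ * x)), hk, mul_inv_cancel_left]
  have hA : ∀ h u, A (leftRegular G h u) = leftRegular G h (A u) := by
    intro h u
    refine Eq.trans (congrArg ι ?_) (leftRegular_toLp h (A₁ u)).symm
    ext x
    exact hA₁ h u x
  let T : H →L[ℂ] H := ContinuousLinearMap.adjoint A ∘L A
  have hTA : ∀ u v, inner ℂ (T u) v = inner ℂ (A u) (A v) := fun u v =>
    ContinuousLinearMap.adjoint_inner_left A v (A u)
  have hTcomp : IsCompactOperator T :=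
    ((isCompactOperator_innerKernelOperator k).clm_comp ι).clm_comp (ContinuousLinearMap.adjoint A)
  have hTsymm : (T : H →ₗ[ℂ] H).IsSymmetric := fun u v => by
    change inner ℂ (T u) v = inner ℂ u (T v)
    rw [hTA, ← inner_conj_symm u (T v), hTA, inner_conj_symm]
  have hT : ∀ h u, T (leftRegular G h u) = leftRegular G h (T u) := by
    intro h u
    refine ext_inner_right ℂ fun v => ?_
    have hv : v = leftRegular G h (leftRegular G h⁻¹ v) := by
      rw [← Module.End.mul_apply, ← map_mul, mul_inv_cancel, map_one, Module.End.one_apply]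
    rw [hv, leftRegular_inner, hTA, hTA, hA, hA, leftRegular_inner]
  -- A nonzero compact self-adjoint operator has a nonzero eigenvalue, with finite-dimensional
  -- eigenspace. Here that eigenspace is translation invariant, so it contains an irreducible family
  -- `e`; the hypothesis on `f` will force `A (e i) = 0`.
  have hT0 : T = 0 := by
    rw [← ContinuousLinearMap.eq_zero_of_forall_hasEigenvalue_eq_zero hTcomp hTsymm]
    intro c hc
    by_contra hc0
    have := ContinuousLinearMap.finite_dimensional_eigenspace hTcomp c hc0
    obtain ⟨π, e, he, heE, hπ⟩ := exists_irrepMatrix_of_invariant (leftRegular G) leftRegular_inner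
      continuous_leftRegular (Module.End.eigenspace (T : H →ₗ[ℂ] H) c) hc (fun g u hu => by
        rw [Module.End.mem_eigenspace_iff] at hu ⊢
        change T u = _ at hu
        change T (leftRegular G g u) = _
        rw [hT, hu, map_smul])
    have hv : ∀ i g, A₁ (e i) g = ∑ j, π.mat g⁻¹ j i * A₁ (e j) 1 := by
      intro i g
      have h1 := hA₁ g⁻¹ (e i) 1
      rw [inv_inv, mul_one] at h1
      rw [← h1, hπ]
      simp
    have hAe : ∀ i, A (e i) = 0 := by
      intro i
      -- It suffices to test continuous `w`. After Fubini and the substitution $x\mapsto yx$, the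
      -- inner integral is a combination of integrals of `f` against coefficients of `π`, all zero.
      have horth : ∀ u : H, inner ℂ (A (e i)) (A u) = 0 := by
        intro u
        refine DenseRange.induction_on (p := fun u => inner ℂ (A (e i)) (A u) = 0)
          (ContinuousMap.toLp_denseRange ℂ (normalizedHaar G) ℂ (p := 2) (by simp)) u
          (isClosed_eq (continuous_const.inner A.continuous) continuous_const) fun w => ?_
        have h1 : inner ℂ (A (e i)) (A (ι w)) =
            ∫ x, A₁ (ι w) x * star (A₁ (e i) x) ∂(normalizedHaar G) :=
          ContinuousMap.inner_toLp _ (A₁ (e i)) (A₁ (ι w))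
        have h2 : ∀ x, A₁ (ι w) x = ∫ y, w y * f (y⁻¹ * x) ∂(normalizedHaar G) := by
          intro x
          refine (ContinuousMap.inner_toLp _ (κ x) w).trans ?_
          simp [hκ]
        refine h1.trans ?_
        simp only [h2, ← integral_mul_const]
        rw [integral_integral_swap_of_hasCompactSupport (by
            simp only [Function.uncurry_def]
            have := (A₁ (e i)).continuous
            fun_prop) (HasCompactSupport.of_compactSpace _)]
        refine (integral_congr_ae (Filter.Eventually.of_forall fun y => ?_)).trans
          (integral_zero _ _)
        change ∫ x, w y * f (y⁻¹ * x) * star (A₁ (e i) x) ∂(normalizedHaar G) = 0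
        rw [← integral_mul_left_eq_self _ y]
        have h3 : ∀ x, w y * f (y⁻¹ * (y * x)) * star (A₁ (e i) (y * x)) =
            ∑ j, ∑ l, (w y * star (A₁ (e j) 1) * π.mat y i l) * (f x * π.mat x l j) := by
          intro x
          rw [hv, inv_mul_cancel_left]
          simp only [π.mat_inv_apply, star_sum, star_mul', star_star, π.mat_mul, Matrix.mul_apply,
            Finset.sum_mul, Finset.mul_sum]
          refine Finset.sum_congr rfl fun j _ => Finset.sum_congr rfl fun l _ => ?_
          ring
        have hint : ∀ j l, Integrable (fun x => (w y * star (A₁ (e j) 1) * π.mat y i l) *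
            (f x * π.mat x l j)) (normalizedHaar G) := fun j l =>
          (integrable_normalizedHaar (f.continuous.mul (π.continuous_mat_apply l j))).const_mul _
        simp only [h3]
        rw [integral_finsetSum _ fun j _ => integrable_finsetSum _ fun l _ => hint j l]
        refine Finset.sum_eq_zero fun j _ => ?_
        rw [integral_finsetSum _ fun l _ => hint j l]
        refine Finset.sum_eq_zero fun l _ => ?_
        rw [integral_const_mul, hf, mul_zero]
      exact inner_self_eq_zero.1 (horth (e i))
    let i : Fin π.dim := ⟨0, π.dim_pos⟩
    have h1 : T (e i) = c • e i := Module.End.mem_eigenspace_iff.1 (heE i)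
    have h2 : T (e i) = 0 := by
      change ContinuousLinearMap.adjoint A (A (e i)) = 0
      rw [hAe, map_zero]
    rw [h2] at h1
    exact he.ne_zero i ((smul_eq_zero.1 h1.symm).resolve_left hc0)
  have hA0 : A (k 1) = 0 := by
    rw [← inner_self_eq_zero (𝕜 := ℂ), ← hTA, hT0]
    exact inner_zero_left _
  have hA10 : A₁ (k 1) = 0 :=
    ContinuousMap.toLp_injective (normalizedHaar G) (hA0.trans (map_zero ι).symm)
  -- The value of `A₁ (k 1)` at the identity is the squared norm of `k 1`.
  have hk0 : k 1 = 0 := by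
    rw [← inner_self_eq_zero (𝕜 := ℂ)]
    exact DFunLike.congr_fun hA10 1
  have hκ0 : κ 1 = 0 :=
    ContinuousMap.toLp_injective (normalizedHaar G) (hk0.trans (map_zero ι).symm)
  ext x
  have := DFunLike.congr_fun hκ0 x⁻¹
  rw [hκ] at this
  simpa using this

end HarmonicAnalysis

/-! ### Weak integrals -/

section WeakIntegrals

variable {X : Type*} [NonUnitalCStarAlgebra X] {F : Submodule ℂ (StrongDual ℂ X)}

/-- The norm formula (b) makes $\mathcal F$ separate points. -/
theorem IsDualPair.eq_of_forall_eq (hF : IsDualPair F) {x y : X} (h : ∀ φ ∈ F, φ x = φ y) :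
    x = y := by
  rw [← sub_eq_zero, ← norm_le_zero_iff]
  refine (hF.norm_eq (x - y)).2 ?_
  rintro _ ⟨φ, hφ, -, rfl⟩
  rw [map_sub, h φ hφ, sub_self, norm_zero]

theorem IsDualPair.t2Space (hF : IsDualPair F) : @T2Space X (fTopology F) := by
  have hinj : Function.Injective (pairing F) := fun x y h =>
    hF.eq_of_forall_eq fun φ hφ => LinearMap.congr_fun h ⟨φ, hφ⟩
  exact (WeakBilin.isEmbedding hinj).t2Space

theorem continuous_fTopology_functional {φ : StrongDual ℂ X} (hφ : φ ∈ F) :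
    Continuous[fTopology F, _] (fun x : X => φ x) :=
  WeakBilin.eval_continuous (pairing F) ⟨φ, hφ⟩

theorem continuous_fTopology_iff {Z : Type*} [TopologicalSpace Z] {u : Z → X} :
    Continuous[_, fTopology F] u ↔ ∀ φ ∈ F, Continuous fun z => φ (u z) :=
  ⟨fun h _ hφ => @Continuous.comp Z X ℂ _ (fTopology F) _ _ _
      (continuous_fTopology_functional hφ) h,
    fun h => WeakBilin.continuous_of_continuous_eval (pairing F) fun φ => h φ φ.2⟩

/-- An `F`-continuous functional belongs to `F`; here for compositions with `F`-continuous maps. -/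
theorem exists_functional_comp (T : X →ₗ[ℂ] X)
    (hT : Continuous[fTopology F, fTopology F] (fun x => T x)) {φ : StrongDual ℂ X} (hφ : φ ∈ F) :
    ∃ ψ ∈ F, ∀ x, ψ x = φ (T x) := by
  have hc : Continuous[fTopology F, _] (fun x => φ (T x)) :=
    @Continuous.comp X X ℂ (fTopology F) (fTopology F) _ _ _
      (continuous_fTopology_functional hφ) hT
  let Λ : StrongDual ℂ (WeakBilin (pairing F)) :=
    { toFun := fun x => φ (T x)
      map_add' := fun x y => (congrArg φ (T.map_add x y)).trans (φ.map_add _ _)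
      map_smul' := fun c x => (congrArg φ (T.map_smul c x)).trans (φ.map_smul _ _)
      cont := hc }
  have hsurj : Function.Surjective (WeakBilin.eval (pairing F)) :=
    @LinearMap.dualEmbedding_surjective ℂ X F inferInstance inferInstance inferInstance
      inferInstance inferInstance (pairing F)
  obtain ⟨ψ, hψ⟩ := hsurj Λ
  exact ⟨ψ, ψ.2, fun x => DFunLike.congr_fun hψ x⟩

/-- Barycentres: a weakly continuous function with values in a convex set with compact closure has
a weak integral in that closure. -/
theorem exists_mem_closure_forall_eq_integral {W ι K : Type*} [TopologicalSpace W]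
    [AddCommGroup W] [Module ℝ W] [TopologicalSpace K] [CompactSpace K] [MeasurableSpace K]
    [OpensMeasurableSpace K] (μ : Measure K) [IsProbabilityMeasure μ] (p : ι → W →ₗ[ℝ] ℂ)
    (hp : ∀ i, Continuous (p i)) {C : Set W} (hC : Convex ℝ C) (hK : IsCompact (closure C))
    (u : K → W) (hu : ∀ k, u k ∈ C) (hcont : ∀ i, Continuous fun k => p i (u k)) :
    ∃ y ∈ closure C, ∀ i, p i y = ∫ k, p i (u k) ∂μ := by
  -- Compactness reduces the claim to finitely many functionals, hence to the mean of a continuous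
  -- function in a closed convex subset of a finite-dimensional space.
  have key := hK.inter_iInter_nonempty (fun i => {y | p i y = ∫ k, p i (u k) ∂μ})
    (fun i => isClosed_eq (hp i) continuous_const) (fun s => ?_)
  · obtain ⟨y, hy, hy'⟩ := key
    exact ⟨y, hy, fun i => Set.mem_iInter.1 hy' i⟩
  · let Φ : W →ₗ[ℝ] (s → ℂ) := LinearMap.pi fun i => p i
    have hΦ : Continuous Φ := continuous_pi fun i => hp i
    have hint : Continuous fun k => Φ (u k) := continuous_pi fun i => hcont i
    have hmem : ∫ k, Φ (u k) ∂μ ∈ closure (Φ '' C) :=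
      (hC.linear_image Φ).closure.integral_mem isClosed_closure
        (Filter.Eventually.of_forall fun k => subset_closure ⟨u k, hu k, rfl⟩)
        (hint.integrable_of_hasCompactSupport (HasCompactSupport.of_compactSpace _))
    have hsub : closure (Φ '' C) ⊆ Φ '' closure C :=
      closure_minimal (Set.image_mono subset_closure) (hK.image hΦ).isClosed
    obtain ⟨y, hy, hyΦ⟩ := hsub hmem
    refine ⟨y, hy, Set.mem_iInter₂.2 fun i hi => ?_⟩
    have := congrFun hyΦ ⟨i, hi⟩
    rw [Set.mem_ofPred_eq]
    refine this.trans ?_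
    exact ((ContinuousLinearMap.proj (R := ℝ) (φ := fun _ : s => ℂ) ⟨i, hi⟩).integral_comp_comm
      (hint.integrable_of_hasCompactSupport (HasCompactSupport.of_compactSpace _))).symm

variable {G : Type*} [Group G] [TopologicalSpace G] [IsTopologicalGroup G] [CompactSpace G]
  [MeasurableSpace G] [BorelSpace G] {α : G →* (X ≃⋆ₐ[ℂ] X)}

theorem IsFDynamicalSystem.exists_isWeakIntegral (hα : IsFDynamicalSystem F α) {Y : Submodule ℂ X}
    (hY : IsClosed[fTopology F] (Y : Set X)) (hYα : ∀ g, ∀ y ∈ Y, α g y ∈ Y) {f : G → ℂ}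
    (hf : Continuous f) {x : X} (hx : x ∈ Y) :
    ∃ y ∈ Y, IsWeakIntegral F (fun g => f g • α g x) y := by
  let u : G → X := fun g => f g • α g x
  have hu : ∀ φ ∈ F, Continuous fun g => φ (u g) := fun φ hφ => by
    simp only [u, map_smul, smul_eq_mul]
    exact hf.mul (hα.continuous_orbit φ hφ x)
  have huc : Continuous[_, fTopology F] u := continuous_fTopology_iff.2 hu
  have hT2 := hα.dualPair.t2Space
  have hS : IsRelCompact (fTopology F) (Set.range u) :=
    @IsCompact.closure X (fTopology F) (@T2Space.r1Space X (fTopology F) hT2) _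
      (@isCompact_range G X _ (fTopology F) _ u huc)
  -- Condition (d), applied to the compact range of the weighted orbit.
  have hK := hα.dualPair.convexHull_relCompact _ hS
  obtain ⟨y, hy, hyF⟩ := @exists_mem_closure_forall_eq_integral X F G (fTopology F) _ _ _ _ _ _
    (normalizedHaar G) _ (fun φ => (φ.1.toLinearMap).restrictScalars ℝ)
    (fun φ => continuous_fTopology_functional φ.2) _ (convex_convexHull ℝ (Set.range u)) hK u
    (fun g => subset_convexHull ℝ _ ⟨g, rfl⟩) (fun φ => hu φ φ.2)
  refine ⟨y, ?_, fun φ hφ => hyF ⟨φ, hφ⟩⟩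
  refine (@closure_minimal X (fTopology F) _ _ ?_ hY) hy
  refine convexHull_min ?_ (Y.restrictScalars ℝ).convex
  rintro _ ⟨g, rfl⟩
  exact Y.smul_mem _ (hYα g x hx)

/-- `F`-continuous linear maps commute with weak integrals. -/
theorem IsWeakIntegral.map {f : G → X} {y : X} (hy : IsWeakIntegral F f y) (T : X →ₗ[ℂ] X)
    (hT : Continuous[fTopology F, fTopology F] (fun x => T x)) :
    IsWeakIntegral F (fun g => T (f g)) (T y) := by
  intro φ hφ
  obtain ⟨ψ, hψ, h⟩ := exists_functional_comp T hT hφ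
  simpa only [h] using hy ψ hψ

end WeakIntegrals

/-! ### Spectral subspaces -/

section SpectralAlgebra

variable {X : Type*} [NonUnitalCStarAlgebra X] {d : ℕ}

theorem rmulScalar_rmulScalar (a : CStarMatrix (Fin d) (Fin d) X)
    (U V : Matrix (Fin d) (Fin d) ℂ) :
    rmulScalar (rmulScalar a U) V = rmulScalar a (U * V) := by
  ext i j
  simp only [rmulScalar_apply, Matrix.mul_apply, Finset.smul_sum, Finset.sum_smul, smul_smul]
  rw [Finset.sum_comm]
  simp only [mul_comm]

theorem rmulScalar_one (a : CStarMatrix (Fin d) (Fin d) X) : rmulScalar a 1 = a := by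
  ext i j
  simp [Matrix.one_apply, ite_smul]

/-- The element `p ⊗ 1` of `X ⊗ M_d(ℂ)`. -/
def diagonalOf (d : ℕ) (p : X) : CStarMatrix (Fin d) (Fin d) X :=
  CStarMatrix.ofMatrix fun i j => if i = j then p else 0

theorem diagonalOf_apply (p : X) (i j : Fin d) :
    diagonalOf d p i j = if i = j then p else 0 := rfl

@[simp]
theorem diagonalOf_mul_apply (p : X) (a : CStarMatrix (Fin d) (Fin d) X) (i j : Fin d) :
    (diagonalOf d p * a) i j = p * a i j := by
  simp [CStarMatrix.mul_apply, diagonalOf_apply]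

@[simp]
theorem mul_diagonalOf_apply (p : X) (a : CStarMatrix (Fin d) (Fin d) X) (i j : Fin d) :
    (a * diagonalOf d p) i j = a i j * p := by
  simp [CStarMatrix.mul_apply, diagonalOf_apply]

theorem star_diagonalOf (p : X) : star (diagonalOf d p) = diagonalOf d (star p) := by
  ext i j
  simp only [CStarMatrix.star_apply, diagonalOf_apply, eq_comm (a := j)]
  split_ifs <;> simp

theorem matrix_mul_smul (r : ℂ) (a b : CStarMatrix (Fin d) (Fin d) X) :
    a * (r • b) = r • (a * b) := by
  ext i j
  simp [CStarMatrix.mul_apply, Finset.smul_sum, mul_smul_comm]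

theorem matrix_smul_mul (r : ℂ) (a b : CStarMatrix (Fin d) (Fin d) X) :
    (r • a) * b = r • (a * b) := by
  ext i j
  simp [CStarMatrix.mul_apply, Finset.smul_sum, smul_mul_assoc]

theorem matrix_eq_zero_iff {a : CStarMatrix (Fin d) (Fin d) X} :
    a = 0 ↔ ∀ i j, a i j = 0 := by
  refine ⟨fun h i j => by rw [h]; rfl, fun h => ?_⟩
  ext i j
  exact h i j

theorem exists_apply_ne_zero {a : CStarMatrix (Fin d) (Fin d) X} (ha : a ≠ 0) :
    ∃ i j, a i j ≠ 0 := by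
  by_contra! h
  exact ha (matrix_eq_zero_iff.2 h)

/-- A row of `a` whose `i`-th diagonal entry of `a a*` vanishes is zero. -/
theorem apply_eq_zero_of_mul_star_apply_eq_zero [PartialOrder X] [StarOrderedRing X]
    {a : CStarMatrix (Fin d) (Fin d) X} {i : Fin d} (h : (a * star a) i i = 0) (j : Fin d) :
    a i j = 0 := by
  simp only [CStarMatrix.mul_apply, CStarMatrix.star_apply] at h
  rw [Finset.sum_eq_zero_iff_of_nonneg fun k _ => mul_star_self_nonneg _] at h
  exact CStarRing.mul_star_self_eq_zero_iff _ |>.1 (h j (Finset.mem_univ j))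

theorem matrix_eq_zero_of_mul_star_self_eq_zero [PartialOrder X] [StarOrderedRing X]
    {a : CStarMatrix (Fin d) (Fin d) X} (h : a * star a = 0) : a = 0 :=
  matrix_eq_zero_iff.2 fun i j =>
    apply_eq_zero_of_mul_star_apply_eq_zero (matrix_eq_zero_iff.1 h i i) j

theorem entrywise_diagonalOf {G : Type*} [Group G] {α : G →* (X ≃⋆ₐ[ℂ] X)} {p : X}
    (hp : ∀ g, α g p = p) (g : G) :
    entrywise (α g) (diagonalOf d p) = diagonalOf d p := by
  ext i j
  rw [entrywise_apply, diagonalOf_apply]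
  split_ifs <;> simp [hp]

variable {G : Type*} [Group G] [TopologicalSpace G] {α : G →* (X ≃⋆ₐ[ℂ] X)} {π : IrrepMatrix G}
  {Y : NonUnitalStarSubalgebra ℂ X} {a b c : CStarMatrix (Fin π.dim) (Fin π.dim) X}

/-- Isolating the action of `α` on one side turns products of fixed and spectral elements into a
cancellation of adjacent factors $\pi_g$ and $\pi_g^*$. -/
theorem mem_fixedAlgebra_iff :
    a ∈ fixedAlgebra α π Y ↔ (∀ i j, a i j ∈ Y) ∧
      ∀ g, entrywise (α g) a = lmulScalar (star (π.mat g)) (rmulScalar a (π.mat g)) := by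
  refine and_congr_right fun _ => forall_congr' fun g => ?_
  rw [adAction]
  constructor
  · intro h
    conv_rhs => rw [← h]
    rw [← lmulScalar_rmulScalar, lmulScalar_lmulScalar, rmulScalar_rmulScalar, π.mat_star_mul,
      rmulScalar_one, lmulScalar_one]
  · intro h
    rw [h, ← lmulScalar_rmulScalar, rmulScalar_rmulScalar, lmulScalar_lmulScalar, π.mat_mul_star,
      rmulScalar_one, lmulScalar_one]

theorem spectralSubspaceTwo_mono_top (ha : a ∈ spectralSubspaceTwo α π Y) :
    a ∈ spectralSubspaceTwo α π ⊤ :=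
  ⟨fun _ _ => trivial, ha.2⟩

theorem fixedAlgebra_mono_top (ha : a ∈ fixedAlgebra α π Y) : a ∈ fixedAlgebra α π ⊤ :=
  ⟨fun _ _ => trivial, ha.2⟩

theorem mul_apply_mem (ha : ∀ i j, a i j ∈ Y) (hb : ∀ i j, b i j ∈ Y) (i j : Fin π.dim) :
    (a * b) i j ∈ Y := by
  rw [CStarMatrix.mul_apply]
  exact sum_mem fun k _ => mul_mem (ha i k) (hb k j)

theorem star_apply_mem (ha : ∀ i j, a i j ∈ Y) (i j : Fin π.dim) : star a i j ∈ Y := by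
  rw [CStarMatrix.star_apply]
  exact star_mem (ha j i)

/-- The outer factors supply $\pi_g^*$ on the left and $\pi_g$ on the right. This transports
matrices over $X^\alpha$ into the fixed point algebra of $\alpha\otimes ad\pi$. -/
theorem star_mul_mul_mem_fixedAlgebra (ha : a ∈ spectralSubspaceTwo α π ⊤)
    (hb : ∀ g, entrywise (α g) b = b) (hc : c ∈ spectralSubspaceTwo α π ⊤) :
    star a * b * c ∈ fixedAlgebra α π ⊤ := by
  refine mem_fixedAlgebra_iff.2 ⟨fun _ _ => trivial, fun g => ?_⟩
  rw [entrywise_mul, entrywise_mul, entrywise_star, ha.2 g, hb g, hc.2 g, star_rmulScalar,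
    rmulScalar_mul, lmulScalar_mul, lmulScalar_mul]

theorem star_mul_mem_fixedAlgebra (ha : a ∈ spectralSubspaceTwo α π Y)
    (hb : b ∈ spectralSubspaceTwo α π Y) : star a * b ∈ fixedAlgebra α π Y := by
  refine mem_fixedAlgebra_iff.2 ⟨mul_apply_mem (star_apply_mem ha.1) hb.1, fun g => ?_⟩
  rw [entrywise_mul, entrywise_star, ha.2 g, hb.2 g, star_rmulScalar, rmulScalar_mul,
    lmulScalar_mul]

theorem mul_mem_spectralSubspaceTwo (ha : a ∈ spectralSubspaceTwo α π Y)
    (hb : b ∈ fixedAlgebra α π Y) : a * b ∈ spectralSubspaceTwo α π Y := by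
  refine ⟨mul_apply_mem ha.1 (mem_fixedAlgebra_iff.1 hb).1, fun g => ?_⟩
  rw [entrywise_mul, ha.2 g, (mem_fixedAlgebra_iff.1 hb).2 g, rmulScalar_mul_eq,
    lmulScalar_lmulScalar, π.mat_mul_star, lmulScalar_one, rmulScalar_mul]

/-- The factors $\pi_g\pi_g^*$ meet in the middle and cancel; this is the source of elements of
$X^\alpha$. -/
theorem entrywise_mul_star_eq (ha : a ∈ spectralSubspaceTwo α π ⊤)
    (hb : b ∈ spectralSubspaceTwo α π ⊤) (g : G) :
    entrywise (α g) (a * star b) = a * star b := by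
  rw [entrywise_mul, entrywise_star, ha.2 g, hb.2 g, star_rmulScalar, rmulScalar_mul_eq,
    lmulScalar_lmulScalar, π.mat_mul_star, lmulScalar_one]

theorem map_mul_star_apply (ha : a ∈ spectralSubspaceTwo α π ⊤)
    (hb : b ∈ spectralSubspaceTwo α π ⊤) (g : G) (i j : Fin π.dim) :
    α g ((a * star b) i j) = (a * star b) i j := by
  rw [← entrywise_apply, entrywise_mul_star_eq ha hb]

theorem mul_mem_spectralSubspaceTwo_of_fixed (hb : ∀ g, entrywise (α g) b = b)
    (ha : a ∈ spectralSubspaceTwo α π ⊤) : b * a ∈ spectralSubspaceTwo α π ⊤ := by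
  refine ⟨fun _ _ => trivial, fun g => ?_⟩
  rw [entrywise_mul, hb, ha.2, rmulScalar_mul]

theorem lmulScalar_diagonalOf (U : Matrix (Fin d) (Fin d) ℂ) (p : X) :
    lmulScalar U (diagonalOf d p) = rmulScalar (diagonalOf d p) U := by
  ext i j
  simp [diagonalOf_apply]

theorem diagonalOf_mem_fixedAlgebra {p : X} (hp : ∀ g, α g p = p) (hpY : p ∈ Y) :
    diagonalOf π.dim p ∈ fixedAlgebra α π Y := by
  refine mem_fixedAlgebra_iff.2 ⟨fun i j => ?_, fun g => ?_⟩
  · rw [diagonalOf_apply]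
    split_ifs
    exacts [hpY, zero_mem Y]
  · rw [entrywise_diagonalOf hp, ← lmulScalar_diagonalOf, lmulScalar_lmulScalar, π.mat_star_mul,
      lmulScalar_one]

theorem diagonalOf_ne_zero {p : X} (hp : p ≠ 0) (hd : 0 < d) : diagonalOf d p ≠ 0 := by
  intro h
  have := matrix_eq_zero_iff.1 h ⟨0, hd⟩ ⟨0, hd⟩
  rw [diagonalOf_apply, if_pos rfl] at this
  exact hp this

theorem spectralIdeal_isTwoSidedIdealIn (α : G →* (X ≃⋆ₐ[ℂ] X)) (π : IrrepMatrix G)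
    (Y : NonUnitalStarSubalgebra ℂ X) :
    IsTwoSidedIdealIn (fixedAlgebra α π Y) (spectralIdeal α π Y) := by
  refine ⟨fun x hx => ?_, fun b hb x hx => ?_⟩
  · induction hx using Submodule.span_induction with
    | mem x h =>
      obtain ⟨a, ha, c, hc, rfl⟩ := h
      exact star_mul_mem_fixedAlgebra ha hc
    | zero => exact zero_mem _
    | add x y _ _ hx hy => exact add_mem hx hy
    | smul r x _ hx => exact SMulMemClass.smul_mem r hx
  · induction hx using Submodule.span_induction with
    | mem x h =>
      obtain ⟨a, ha, c, hc, rfl⟩ := h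
      constructor
      · refine Submodule.subset_span
          ⟨a * star b, mul_mem_spectralSubspaceTwo ha (star_mem hb), c, hc, ?_⟩
        rw [star_mul, star_star, mul_assoc]
      · exact Submodule.subset_span
          ⟨a, ha, c * b, mul_mem_spectralSubspaceTwo hc hb, mul_assoc _ _ _⟩
    | zero => simp
    | add x y _ _ hx hy =>
      rw [mul_add, add_mul]
      exact ⟨add_mem hx.1 hy.1, add_mem hx.2 hy.2⟩
    | smul r x _ hx =>
      rw [matrix_mul_smul, matrix_smul_mul]
      exact ⟨Submodule.smul_mem _ r hx.1, Submodule.smul_mem _ r hx.2⟩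

/-- The annihilator of `Y₂(π)* Y₂(π)` in terms of `Y₂(π)`. -/
theorem forall_mul_spectralIdeal_eq_zero_iff [PartialOrder X] [StarOrderedRing X] :
    (∀ x ∈ spectralIdeal α π Y, b * x = 0) ↔ ∀ a ∈ spectralSubspaceTwo α π Y, a * star b = 0 := by
  constructor
  · intro h a ha
    have h1 : b * (star a * a) = 0 := h _ (Submodule.subset_span ⟨a, ha, a, ha, rfl⟩)
    have h2 : a * star b = star (b * star a) := by rw [star_mul, star_star]
    rw [h2, star_eq_zero]
    refine matrix_eq_zero_of_mul_star_self_eq_zero ?_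
    rw [star_mul, star_star, mul_assoc, ← mul_assoc (star a), ← mul_assoc, h1, zero_mul]
  · intro h x hx
    induction hx using Submodule.span_induction with
    | mem x hx =>
      obtain ⟨a, ha, c, hc, rfl⟩ := hx
      have h2 : b * star a = star (a * star b) := by rw [star_mul, star_star]
      rw [← mul_assoc, h2, h a ha, star_zero, zero_mul]
    | zero => simp
    | add x y _ _ hx hy => rw [mul_add, hx, hy, add_zero]
    | smul r x _ hx => rw [matrix_mul_smul, hx, smul_zero]

end SpectralAlgebra

/-! ### Fourier analysis of the action -/

section FourierAnalysis

variable {X : Type*} [NonUnitalCStarAlgebra X] {F : Submodule ℂ (StrongDual ℂ X)}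
variable {G : Type*} [Group G] [TopologicalSpace G] [IsTopologicalGroup G] [CompactSpace G]
  [MeasurableSpace G] [BorelSpace G] {α : G →* (X ≃⋆ₐ[ℂ] X)}

/-- The matrix of Fourier coefficients `∫ conj (π_ji(g)) α_g(x) dg` of an element `x` exists and
belongs to `X₂(π)`. -/
theorem IsFDynamicalSystem.exists_fourierMatrix (hα : IsFDynamicalSystem F α) {Y : Submodule ℂ X}
    (hY : IsClosed[fTopology F] (Y : Set X)) (hYα : ∀ g, ∀ y ∈ Y, α g y ∈ Y)
    (π : IrrepMatrix G) {x : X} (hx : x ∈ Y) :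
    ∃ a ∈ spectralSubspaceTwo α π ⊤, (∀ i j, a i j ∈ Y) ∧
      ∀ i j, IsWeakIntegral F (fun g => star (π.mat g j i) • α g x) (a i j) := by
  choose a haY ha using fun i j =>
    hα.exists_isWeakIntegral hY hYα (π.continuous_star_mat_apply j i) hx
  refine ⟨CStarMatrix.ofMatrix a, ⟨fun _ _ => trivial, fun h => ?_⟩, haY, ha⟩
  ext i j
  change α h (a i j) = ∑ k, π.mat h k j • a i k
  refine hα.dualPair.eq_of_forall_eq fun φ hφ => ?_
  have h1 := (ha i j).map (T := ((α h : X ≃⋆ₐ[ℂ] X) : X →ₗ[ℂ] X)) (hα.continuous_aut h) φ hφ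
  refine h1.trans ?_
  -- Written as a function of $hg$, so that left invariance moves $h$ from the action to the
  -- coefficient, where multiplicativity of `π` expands it.
  have h2 : ∀ g, φ (α h (star (π.mat g j i) • α g x)) =
      star (π.mat (h⁻¹ * (h * g)) j i) * φ (α (h * g) x) := by
    intro g
    rw [inv_mul_cancel_left, map_smul, map_smul, map_mul, smul_eq_mul]
    rfl
  refine (integral_congr_ae (Filter.Eventually.of_forall h2)).trans ?_
  refine (integral_mul_left_eq_self
    (fun g => star (π.mat (h⁻¹ * g) j i) * φ (α g x)) h).trans ?_
  have h3 : ∀ g, star (π.mat (h⁻¹ * g) j i) * φ (α g x) =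
      ∑ k, π.mat h k j * φ (star (π.mat g k i) • α g x) := by
    intro g
    simp only [π.mat_mul, Matrix.mul_apply, π.mat_inv_apply, star_sum, star_mul', star_star,
      Finset.sum_mul, map_smul, smul_eq_mul, mul_assoc]
  simp only [h3]
  rw [integral_finsetSum _ fun k _ => Integrable.const_mul (integrable_normalizedHaar ?_) _]
  · simp only [integral_const_mul, map_sum, map_smul, smul_eq_mul]
    exact Finset.sum_congr rfl fun k _ => by
      rw [ha i k φ hφ]
      simp only [map_smul, smul_eq_mul]
  · simp only [map_smul, smul_eq_mul]
    exact (π.continuous_star_mat_apply k i).mul (hα.continuous_orbit φ hφ x)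

/-- A functional in `F` that vanishes on all the spectral components of `x` vanishes at `x`. -/
theorem IsFDynamicalSystem.functional_eq_zero [T2Space G] (hα : IsFDynamicalSystem F α)
    {Y : Submodule ℂ X} (hY : IsClosed[fTopology F] (Y : Set X))
    (hYα : ∀ g, ∀ y ∈ Y, α g y ∈ Y) {x : X} (hx : x ∈ Y) {φ : StrongDual ℂ X} (hφ : φ ∈ F)
    (h : ∀ π : GroupDual G, ∀ a ∈ spectralSubspaceTwo α π.rep ⊤, (∀ i j, a i j ∈ Y) →
      ∀ i j, φ (a i j) = 0) : φ x = 0 := by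
  -- Fourier coefficients use conjugated matrix entries, whereas completeness tests against
  -- unconjugated ones; hence the conjugate.
  let f : C(G, ℂ) := ⟨fun g => star (φ (α g x)), (hα.continuous_orbit φ hφ x).star⟩
  have hrep : ∀ (π : GroupDual G) i j, ∫ g, f g * π.rep.mat g i j ∂(normalizedHaar G) = 0 := by
    intro π i j
    obtain ⟨a, ha, haY, hint⟩ := hα.exists_fourierMatrix hY hYα π.rep hx
    have h1 := hint j i φ hφ
    rw [h π a ha haY] at h1
    have h2 : ∀ g, f g * π.rep.mat g i j = star (φ (star (π.rep.mat g i j) • α g x)) := by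
      intro g
      rw [map_smul, smul_eq_mul, star_mul', star_star, mul_comm]
      rfl
    simp only [h2]
    refine (integral_conj (f := fun g => φ (star (π.rep.mat g i j) • α g x))).trans ?_
    change star _ = _
    rw [← h1, star_zero]
  have hf : f = 0 := by
    refine eq_zero_of_forall_integral_mul_mat_eq_zero f fun π i j => ?_
    -- Coefficients of an arbitrary `π` are linear combinations of those of the chosen
    -- representative of its class.
    let c : GroupDual G := Quotient.mk (irrepSetoid G) π
    obtain ⟨U, hU1, -, hU⟩ : UnitarilyEquivalent π c.rep :=
      unitarilyEquivalent_equivalence.symm (Quotient.mk_out (s := irrepSetoid G) π)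
    have hmat : ∀ g, f g * π.mat g i j =
        ∑ l, ∑ k, (U.conjTranspose i k * U l j) * (f g * c.rep.mat g k l) := by
      intro g
      have : π.mat g = U.conjTranspose * c.rep.mat g * U := by
        rw [Matrix.mul_assoc, ← hU, ← Matrix.mul_assoc, hU1, Matrix.one_mul]
      rw [this]
      simp only [Matrix.mul_apply, Finset.mul_sum, Finset.sum_mul]
      refine Finset.sum_congr rfl fun l _ => Finset.sum_congr rfl fun k _ => ?_
      ring
    have hi : ∀ l k, Integrable (fun g => (U.conjTranspose i k * U l j) *
        (f g * c.rep.mat g k l)) (normalizedHaar G) := fun l k =>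
      (integrable_normalizedHaar (f.continuous.mul (c.rep.continuous_mat_apply k l))).const_mul _
    simp only [hmat]
    rw [integral_finsetSum _ fun l _ => integrable_finsetSum _ fun k _ => hi l k]
    refine Finset.sum_eq_zero fun l _ => ?_
    rw [integral_finsetSum _ fun k _ => hi l k]
    refine Finset.sum_eq_zero fun k _ => ?_
    rw [integral_const_mul, hrep, mul_zero]
  have := DFunLike.congr_fun hf 1
  simpa [f] using this

/-- A non-zero invariant `F`-closed subspace contains the entries of a non-zero element of a
spectral subspace. -/
theorem IsFDynamicalSystem.exists_spectral_ne_zero [T2Space G] (hα : IsFDynamicalSystem F α)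
    {Y : Submodule ℂ X} (hY : IsClosed[fTopology F] (Y : Set X))
    (hYα : ∀ g, ∀ y ∈ Y, α g y ∈ Y) {x : X} (hx : x ∈ Y) (hx0 : x ≠ 0) :
    ∃ π : GroupDual G, ∃ a ∈ spectralSubspaceTwo α π.rep ⊤, (∀ i j, a i j ∈ Y) ∧ a ≠ 0 := by
  by_contra! hcon
  refine hx0 (hα.dualPair.eq_of_forall_eq fun φ hφ => ?_)
  rw [map_zero]
  refine hα.functional_eq_zero hY hYα hx hφ fun π a ha haY i j => ?_
  rw [hcon π a ha haY]
  exact map_zero φ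

theorem isClosed_univ_fTopology : IsClosed[fTopology F] (Set.univ : Set X) :=
  @isClosed_univ X (fTopology F)

/-- `X₁(π)` is non-zero if and only if `X₂(π)` is non-zero. -/
theorem IsFDynamicalSystem.spectralSubspaceOne_ne_iff (hα : IsFDynamicalSystem F α)
    (ρ : IrrepMatrix G) :
    spectralSubspaceOne F α ρ ≠ {0} ↔ ∃ a ∈ spectralSubspaceTwo α ρ ⊤, a ≠ 0 := by
  have hzero : (0 : X) ∈ spectralSubspaceOne F α ρ := fun φ _ => by simp
  constructor
  · intro h
    obtain ⟨x, hx, hx0⟩ : ∃ x ∈ spectralSubspaceOne F α ρ, x ≠ 0 := by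
      by_contra! hcon
      exact h (Set.eq_singleton_iff_unique_mem.2 ⟨hzero, hcon⟩)
    obtain ⟨a, ha, -, hint⟩ := hα.exists_fourierMatrix (Y := ⊤) isClosed_univ_fTopology
      (fun _ _ _ => trivial) ρ (x := x) trivial
    refine ⟨a, ha, fun ha0 => hx0 (hα.dualPair.eq_of_forall_eq fun φ hφ => ?_)⟩
    rw [hx φ hφ, map_zero]
    have h1 : ∀ g, φ (ρ.chi g • α g x) = (ρ.dim : ℂ) * ∑ i, φ (star (ρ.mat g i i) • α g x) := by
      intro g
      simp only [map_smul, smul_eq_mul, IrrepMatrix.chi, ← Finset.sum_mul, mul_assoc]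
    simp only [h1]
    rw [integral_const_mul, integral_finsetSum _ fun i _ => integrable_normalizedHaar ?_]
    · refine mul_eq_zero_of_right _ (Finset.sum_eq_zero fun i _ => ?_)
      rw [← hint i i φ hφ, ha0]
      exact map_zero φ
    · simp only [map_smul, smul_eq_mul]
      exact (ρ.continuous_star_mat_apply i i).mul (hα.continuous_orbit φ hφ x)
  · rintro ⟨a, ha, ha0⟩ h
    obtain ⟨i, j, hij⟩ := exists_apply_ne_zero ha0
    refine hij (?_ : a i j ∈ ({0} : Set X))
    rw [← h]
    intro φ hφ
    -- Covariance of `a` reduces the character integral to Schur orthogonality, which leaves only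
    -- the term $k=m=j$: every entry of `a` lies in $X_1$.
    have h1 : ∀ g, φ (ρ.chi g • α g (a i j)) =
        ∑ k, ∑ m, φ (a i k) * ((ρ.dim : ℂ) * (ρ.mat g k j * star (ρ.mat g m m))) := by
      intro g
      have h2 := congrArg (fun b : CStarMatrix _ _ X => b i j) (ha.2 g)
      simp only [entrywise_apply, rmulScalar_apply] at h2
      rw [h2]
      simp only [map_smul, map_sum, smul_eq_mul, IrrepMatrix.chi, Finset.mul_sum, Finset.sum_mul]
      refine Finset.sum_congr rfl fun k _ => Finset.sum_congr rfl fun m _ => ?_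
      ring
    have hi : ∀ k m, Integrable (fun g => φ (a i k) *
        ((ρ.dim : ℂ) * (ρ.mat g k j * star (ρ.mat g m m)))) (normalizedHaar G) := fun k m =>
      ((integrable_normalizedHaar ((ρ.continuous_mat_apply k j).mul
        (ρ.continuous_star_mat_apply m m))).const_mul _).const_mul _
    simp only [h1]
    rw [integral_finsetSum _ fun k _ => integrable_finsetSum _ fun m _ => hi k m]
    have h3 : ∀ k, ∫ g, ∑ m, φ (a i k) * ((ρ.dim : ℂ) * (ρ.mat g k j * star (ρ.mat g m m)))
        ∂(normalizedHaar G) = ∑ m, φ (a i k) * (if k = m ∧ j = m then 1 else 0) := by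
      intro k
      rw [integral_finsetSum _ fun m _ => hi k m]
      refine Finset.sum_congr rfl fun m _ => ?_
      rw [integral_const_mul, integral_const_mul, ρ.integral_mat_mul_star_mat]
    simp only [h3]
    rw [Finset.sum_eq_single j (fun k _ hk => Finset.sum_eq_zero fun m _ => ?_) (by simp)]
    · rw [Finset.sum_eq_single j (fun m _ hm => ?_) (by simp)]
      · simp
      · rw [if_neg fun hc => hm hc.2.symm, mul_zero]
    · rw [if_neg fun hc => hk (hc.1.trans hc.2.symm), mul_zero]

theorem IsFDynamicalSystem.mem_spec_iff (hα : IsFDynamicalSystem F α) (π : GroupDual G) :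
    π ∈ spec F α ↔ ∃ a ∈ spectralSubspaceTwo α π.rep ⊤, a ≠ 0 :=
  hα.spectralSubspaceOne_ne_iff π.rep

end FourierAnalysis

/-! ### Weakly closed annihilators and the spectrum of a subalgebra -/

section Closures

variable {X : Type*} [NonUnitalCStarAlgebra X] {F : Submodule ℂ (StrongDual ℂ X)}
variable {G : Type*} [Group G] [TopologicalSpace G] {α : G →* (X ≃⋆ₐ[ℂ] X)}

theorem continuous_matrixFTopology_apply {d : ℕ} (i j : Fin d) :
    Continuous[matrixFTopology F d, fTopology F]
      (fun x : CStarMatrix (Fin d) (Fin d) X => x i j) := by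
  let := fTopology F
  exact continuous_apply_apply i j

/-- Separate continuity of multiplication makes annihilation a closed condition, so passing to the
closure of the spectral ideal does not change its annihilator. -/
theorem IsDualPair.isClosed_setOf_mul_eq_zero (hF : IsDualPair F) {d : ℕ}
    (b : CStarMatrix (Fin d) (Fin d) X) :
    IsClosed[matrixFTopology F d] {x : CStarMatrix (Fin d) (Fin d) X | b * x = 0} := by
  let := matrixFTopology F d (X := X)
  have : {x : CStarMatrix (Fin d) (Fin d) X | b * x = 0} =
      ⋂ i, ⋂ j, ⋂ φ ∈ F, {x | φ ((b * x) i j) = 0} := by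
    ext x
    simp only [Set.mem_iInter]
    refine ⟨fun h i j φ _ => ?_, fun h => matrix_eq_zero_iff.2 fun i j =>
      hF.eq_of_forall_eq fun φ hφ => (h i j φ hφ).trans (map_zero φ).symm⟩
    change φ ((b * x) i j) = 0
    rw [show b * x = 0 from h]
    exact map_zero φ
  rw [this]
  refine isClosed_iInter fun i => isClosed_iInter fun j => isClosed_biInter fun φ hφ => ?_
  refine isClosed_eq ?_ continuous_const
  simp only [CStarMatrix.mul_apply, map_sum]
  refine continuous_finsetSum _ fun k _ => ?_
  exact @Continuous.comp _ X ℂ _ (fTopology F) _ _ _ (continuous_fTopology_functional hφ)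
    (@Continuous.comp _ X X _ (fTopology F) (fTopology F) _ _ (hF.continuous_mul_left (b i k))
      (continuous_matrixFTopology_apply k j))

/-- `sp_F(α|_Y)` in terms of annihilators of `Y₂(π)`. -/
theorem IsDualPair.mem_specF_iff [PartialOrder X] [StarOrderedRing X] (hF : IsDualPair F)
    (Y : NonUnitalStarSubalgebra ℂ X) (π : GroupDual G) :
    π ∈ specF F α Y ↔ ∀ b ∈ fixedAlgebra α π.rep Y,
      (∀ a ∈ spectralSubspaceTwo α π.rep Y, a * star b = 0) → b = 0 := by
  refine forall₂_congr fun b _ => imp_congr_left ?_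
  rw [← forall_mul_spectralIdeal_eq_zero_iff]
  refine ⟨fun h x hx => h x (@subset_closure _ (matrixFTopology F π.rep.dim) _ x hx),
    fun h x hx => ?_⟩
  exact (@closure_minimal _ (matrixFTopology F π.rep.dim) _ _ h
    (hF.isClosed_setOf_mul_eq_zero b)) hx

theorem IsDualPair.isClosed_setOf_eq_zero (hF : IsDualPair F) (T : X → X)
    (hT : Continuous[fTopology F, fTopology F] T) : IsClosed[fTopology F] {x | T x = 0} :=
  @isClosed_eq X X (fTopology F) (fTopology F) hF.t2Space T (fun _ => 0) hT
    (@continuous_const _ _ (fTopology F) (fTopology F) 0)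

end Closures

/-! ### Hereditary subalgebras -/

section Hereditary

variable {X : Type*} [NonUnitalCStarAlgebra X] [PartialOrder X] [StarOrderedRing X]

/-- A hereditary `*`-subalgebra `Y` satisfies `Y X Y ⊆ Y`. -/
theorem mul_mul_mem_of_hereditary {Y : NonUnitalStarSubalgebra ℂ X}
    (hY : ∀ x y : X, 0 ≤ x → x ≤ y → y ∈ Y → x ∈ Y) {y z : X} (hy : y ∈ Y) (hz : z ∈ Y) (x : X) :
    y * x * z ∈ Y := by
  -- Heredity applies because $w^*xw\le\|x\|\,w^*w$.
  have hpos : ∀ w ∈ Y, ∀ x : X, 0 ≤ x → star w * x * w ∈ Y := by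
    intro w hw x hx
    refine hY _ ((‖x‖ : ℂ) • (star w * w)) (star_left_conjugate_nonneg hx w) ?_
      (SMulMemClass.smul_mem _ (mul_mem (star_mem hw) hw))
    have := CStarAlgebra.star_left_conjugate_le_norm_smul (a := w) (b := x)
      (hb := IsSelfAdjoint.of_nonneg hx)
    rwa [← Complex.coe_smul] at this
  have hx : x ∈ Submodule.span ℂ {a : X | 0 ≤ a} := by
    rw [CStarAlgebra.span_nonneg]; trivial
  induction hx using Submodule.span_induction with
  | mem x hx =>
    obtain ⟨w, rfl⟩ : ∃ w, y = star w := ⟨star y, (star_star y).symm⟩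
    have hw : w ∈ Y := by simpa using star_mem hy
    have hI : ∀ c : ℂ, star (z + c • w) * x * (z + c • w) ∈ Y := fun c =>
      hpos _ (add_mem hz (SMulMemClass.smul_mem c hw)) x hx
    -- Polarization expresses the mixed product through four products of the form already handled;
    -- general `x` follows because positive elements span.
    have key : star w * x * z = (4⁻¹ : ℂ) • (star (z + (1 : ℂ) • w) * x * (z + (1 : ℂ) • w)
        - star (z + (-1 : ℂ) • w) * x * (z + (-1 : ℂ) • w)
        + Complex.I • (star (z + Complex.I • w) * x * (z + Complex.I • w))
        - Complex.I • (star (z + (-Complex.I) • w) * x * (z + (-Complex.I) • w))) := by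
      simp only [star_add, star_smul, add_mul, mul_add, smul_mul_assoc, mul_smul_comm, smul_add,
        smul_smul, Complex.star_def, map_one, map_neg, Complex.conj_I]
      match_scalars <;> ring_nf <;> simp [Complex.I_sq] <;> norm_num
    rw [key]
    exact SMulMemClass.smul_mem _ (sub_mem (add_mem (sub_mem (hI _) (hI _))
      (SMulMemClass.smul_mem _ (hI _))) (SMulMemClass.smul_mem _ (hI _)))
  | zero => simp
  | add a b _ _ ha hb => rw [mul_add, add_mul]; exact add_mem ha hb
  | smul c a _ ha => rw [mul_smul_comm, smul_mul_assoc]; exact SMulMemClass.smul_mem c ha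

end Hereditary

/-! ### Primeness of the fixed point algebra -/

section FixedPoints

variable {X : Type*} [NonUnitalCStarAlgebra X] {F : Submodule ℂ (StrongDual ℂ X)}

theorem IsDualPair.isClosed_setOf_forall_eq_zero (hF : IsDualPair F) {ι : Type*} (S : Set ι)
    (T : ι → X → X) (hT : ∀ i ∈ S, Continuous[fTopology F, fTopology F] (T i)) :
    IsClosed[fTopology F] {x | ∀ i ∈ S, T i x = 0} := by
  have h : {x | ∀ i ∈ S, T i x = 0} = ⋂ i ∈ S, {x | T i x = 0} := by
    ext x
    simp
  rw [h]
  exact @isClosed_biInter X ι (fTopology F) S _ fun i hi => hF.isClosed_setOf_eq_zero _ (hT i hi)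

/-- The fixed point algebra `X^α` is prime, in the elementwise formulation. -/
def IsFixedPrime {G : Type*} [Group G] (α : G →* (X ≃⋆ₐ[ℂ] X)) : Prop :=
  ∀ p q : X, (∀ g, α g p = p) → (∀ g, α g q = q) →
    (∀ z, (∀ g, α g z = z) → p * z * q = 0) → p ≠ 0 → q = 0

theorem map_star_eq {G : Type*} [Group G] {α : G →* (X ≃⋆ₐ[ℂ] X)} {p : X}
    (hp : ∀ g, α g p = p) (g : G) : α g (star p) = star p := by
  rw [map_star, hp]

theorem map_mul_eq {G : Type*} [Group G] {α : G →* (X ≃⋆ₐ[ℂ] X)} {p q : X}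
    (hp : ∀ g, α g p = p) (hq : ∀ g, α g q = q) (g : G) : α g (p * q) = p * q := by
  rw [map_mul, hp, hq]

theorem apply_apply_inv {G : Type*} [Group G] (α : G →* (X ≃⋆ₐ[ℂ] X)) (g : G) (x : X) :
    α g (α g⁻¹ x) = x := by
  have : (α g * α g⁻¹) x = x := by rw [← map_mul, mul_inv_cancel, map_one]; rfl
  exact this

/-- The hereditary subalgebra of the elements `y` with `p X^α y = p X^α y* = 0`. -/
def fixedAnnihilator {G : Type*} [Group G] (α : G →* (X ≃⋆ₐ[ℂ] X)) (p : X) :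
    NonUnitalStarSubalgebra ℂ X where
  carrier := {y | ∀ z, (∀ g, α g z = z) → p * z * y = 0 ∧ p * z * star y = 0}
  add_mem' := fun hx hy z hz => by
    rw [star_add, mul_add, mul_add, (hx z hz).1, (hx z hz).2, (hy z hz).1, (hy z hz).2, add_zero]
    exact ⟨rfl, rfl⟩
  zero_mem' := fun z _ => by simp
  mul_mem' := fun hx hy z hz => by
    rw [star_mul, ← mul_assoc, ← mul_assoc, (hx z hz).1, (hy z hz).2, zero_mul, zero_mul]
    exact ⟨rfl, rfl⟩
  smul_mem' := fun c x hx z hz => by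
    rw [star_smul, mul_smul_comm, mul_smul_comm, (hx z hz).1, (hx z hz).2, smul_zero, smul_zero]
    exact ⟨rfl, rfl⟩
  star_mem' := fun hx z hz => by
    rw [star_star]
    exact (hx z hz).symm

theorem isInvariantHereditary_top {G : Type*} [Group G] {α : G →* (X ≃⋆ₐ[ℂ] X)} [PartialOrder X]
    [Nontrivial X] : IsInvariantHereditary F α ⊤ where
  nonzero := (exists_ne (0 : X)).imp fun _ h => ⟨trivial, h⟩
  invariant _ _ _ := trivial
  isClosed := isClosed_univ_fTopology
  hereditary _ _ _ _ _ := trivial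

variable [PartialOrder X] [StarOrderedRing X]

/-- Invariance holds because $pz$ is fixed, and closedness because annihilation is weakly closed. -/
theorem IsFDynamicalSystem.isInvariantHereditary_fixedAnnihilator {G : Type*} [Group G]
    [TopologicalSpace G] {α : G →* (X ≃⋆ₐ[ℂ] X)} (hα : IsFDynamicalSystem F α) {p q : X}
    (hp : ∀ g, α g p = p) (hq : q ∈ fixedAnnihilator α p) (hq0 : q ≠ 0) :
    IsInvariantHereditary F α (fixedAnnihilator α p) where
  nonzero := ⟨q, hq, hq0⟩
  invariant g y hy z hz := by
    have h1 : p * z = α g (p * z) := (map_mul_eq hp hz g).symm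
    rw [h1, ← map_star, ← map_mul, ← map_mul, (hy z hz).1, (hy z hz).2, map_zero]
    exact ⟨rfl, rfl⟩
  isClosed := by
    have hF := hα.dualPair
    have h1 := hF.isClosed_setOf_forall_eq_zero {z | ∀ g, α g z = z} (fun z y => p * z * y)
      fun z _ => hF.continuous_mul_left (p * z)
    have h2 := hF.isClosed_setOf_forall_eq_zero {z | ∀ g, α g z = z} (fun z y => p * z * star y)
      fun z _ => @Continuous.comp X X X (fTopology F) (fTopology F) (fTopology F) _ _
        (hF.continuous_mul_left (p * z)) hF.continuous_star
    convert @IsClosed.inter X _ _ (fTopology F) h1 h2 using 1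
    ext y
    exact ⟨fun hy => ⟨fun z hz => (hy z hz).1, fun z hz => (hy z hz).2⟩,
      fun hy z hz => ⟨hy.1 z hz, hy.2 z hz⟩⟩
  hereditary x y hx hxy hy z hz := by
    rw [(IsSelfAdjoint.of_nonneg hx).star_eq, and_self]
    -- With $w^*=pz$ and $x=s^*s$, one has $0\le w^*xw\le w^*yw=0$, so $sw=0$ and $pzx=(sw)^*s=0$.
    obtain ⟨w, hw⟩ : ∃ w, star w = p * z := ⟨star (p * z), star_star _⟩
    obtain ⟨s, rfl⟩ := CStarAlgebra.nonneg_iff_eq_star_mul_self.1 hx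
    have h1 : star w * (star s * s) * w ≤ 0 := by
      refine (star_left_conjugate_le_conjugate hxy w).trans_eq ?_
      rw [hw, (hy z hz).1, zero_mul]
    have h2 : star (s * w) * (s * w) = 0 := by
      rw [star_mul, mul_assoc, ← mul_assoc (star s), ← mul_assoc]
      exact le_antisymm h1 (star_left_conjugate_nonneg hx w)
    have h3 : star w * star s = 0 := by
      rw [← star_mul, (CStarRing.star_mul_self_eq_zero_iff _).1 h2, star_zero]
    rw [← hw, ← mul_assoc, h3, zero_mul]

theorem exists_mul_star_apply_ne_zero {d : ℕ} {a : CStarMatrix (Fin d) (Fin d) X} (ha : a ≠ 0) :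
    ∃ i, (a * star a) i i ≠ 0 := by
  obtain ⟨i, j, hij⟩ := exists_apply_ne_zero ha
  exact ⟨i, fun h => hij (apply_eq_zero_of_mul_star_apply_eq_zero h j)⟩

/-- The trivial representation, realized as the fixed representative of its class. -/
theorem exists_rep_mat_eq_one (G : Type*) [Group G] [TopologicalSpace G] :
    ∃ π : GroupDual G, ∀ g, π.rep.mat g = 1 := by
  obtain ⟨ρ, e, he, -, hρ⟩ := exists_irrepMatrix_of_invariant (G := G) (H := ℂ) 1
    (fun _ _ _ => rfl) (fun _ => continuous_const) ⊤ top_ne_bot (fun _ _ _ => trivial)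
  have hone : ∀ g, ρ.mat g = 1 := by
    intro g
    ext k i
    have h1 := he.inner_right_fintype (fun j => ρ.mat g j i) k
    rw [← hρ] at h1
    rw [← h1, Matrix.one_apply, ← orthonormal_iff_ite.1 he k i]
    rfl
  let c : GroupDual G := Quotient.mk (irrepSetoid G) ρ
  obtain ⟨U, hU1, -, hU⟩ : UnitarilyEquivalent c.rep ρ :=
    Quotient.mk_out (s := irrepSetoid G) ρ
  refine ⟨c, fun g => ?_⟩
  have : c.rep.mat g = U.conjTranspose * (U * c.rep.mat g) := by
    rw [← Matrix.mul_assoc, hU1, Matrix.one_mul]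
  rw [this, hU, hone, Matrix.one_mul, hU1]

section CompactGroup

variable {G : Type*} [Group G] [TopologicalSpace G] [IsTopologicalGroup G] [CompactSpace G]
  [T2Space G] [MeasurableSpace G] [BorelSpace G] {α : G →* (X ≃⋆ₐ[ℂ] X)}

/-- Some nonzero spectral element $a$ has all its entries in `Y`, and a nonzero diagonal entry of
$aa^*$ is the required fixed element. -/
theorem IsFDynamicalSystem.exists_fixed_ne_zero (hα : IsFDynamicalSystem F α)
    {Y : Submodule ℂ X} (hY : IsClosed[fTopology F] (Y : Set X))
    (hYα : ∀ g, ∀ y ∈ Y, α g y ∈ Y) (hYmul : ∀ y ∈ Y, ∀ z ∈ Y, y * star z ∈ Y) {x : X}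
    (hx : x ∈ Y) (hx0 : x ≠ 0) : ∃ p ∈ Y, p ≠ 0 ∧ ∀ g, α g p = p := by
  obtain ⟨π, a, ha, haY, ha0⟩ := hα.exists_spectral_ne_zero hY hYα hx hx0
  obtain ⟨i, hi⟩ := exists_mul_star_apply_ne_zero ha0
  refine ⟨_, ?_, hi, fun g => map_mul_star_apply ha ha g i i⟩
  rw [CStarMatrix.mul_apply]
  exact sum_mem fun k _ => hYmul _ (haY i k) _ (haY i k)

theorem IsFDynamicalSystem.exists_fixed_ne_zero_of_nontrivial [Nontrivial X]
    (hα : IsFDynamicalSystem F α) : ∃ p : X, p ≠ 0 ∧ ∀ g, α g p = p := by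
  obtain ⟨x, hx⟩ := exists_ne (0 : X)
  obtain ⟨p, -, hp⟩ := hα.exists_fixed_ne_zero (Y := ⊤) isClosed_univ_fTopology
    (fun _ _ _ => trivial) (fun _ _ _ _ => trivial) (x := x) trivial hx
  exact ⟨p, hp⟩

/-- For the trivial representation the fixed point algebra consists of the matrices over $X^\alpha$;
that its dimension is one is never needed. -/
theorem IsFDynamicalSystem.isFixedPrime_of_isFPrime [Nontrivial X] (hα : IsFDynamicalSystem F α)
    (h : ∀ π ∈ spec F α, IsFPrime (fixedAlgebra α π.rep ⊤)) : IsFixedPrime α := by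
  obtain ⟨π, hπ⟩ := exists_rep_mat_eq_one G
  have hmem : ∀ {a : CStarMatrix (Fin π.rep.dim) (Fin π.rep.dim) X},
      a ∈ fixedAlgebra α π.rep ⊤ ↔ ∀ g i j, α g (a i j) = a i j := by
    intro a
    rw [mem_fixedAlgebra_iff]
    simp only [hπ, star_one, rmulScalar_one, lmulScalar_one]
    refine ⟨fun h g i j => ?_, fun h => ⟨fun _ _ => trivial, fun g => ?_⟩⟩
    · rw [← entrywise_apply, h.2]
    · ext i j
      exact h g i j
  have hspec : π ∈ spec F α := by
    obtain ⟨p, hp0, hp⟩ := hα.exists_fixed_ne_zero_of_nontrivial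
    refine (hα.mem_spec_iff π).2 ⟨diagonalOf _ p, ⟨fun _ _ => trivial, fun g => ?_⟩,
      diagonalOf_ne_zero hp0 π.rep.dim_pos⟩
    rw [hπ, rmulScalar_one, entrywise_diagonalOf hp]
  intro p q hp hq hpq hp0
  by_contra hq0
  -- The matrices over $X^\alpha$ whose entries are killed by $pX^\alpha$: an ideal containing
  -- $q\otimes1$.
  let I : Submodule ℂ (CStarMatrix (Fin π.rep.dim) (Fin π.rep.dim) X) :=
    { carrier := {x | (∀ g i j, α g (x i j) = x i j) ∧
        ∀ z, (∀ g, α g z = z) → ∀ i j, p * z * x i j = 0}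
      add_mem' := fun {x y} hx hy => ⟨fun g i j => by
          change α g (x i j + y i j) = x i j + y i j
          rw [map_add, hx.1, hy.1], fun z hz i j => by
          change p * z * (x i j + y i j) = 0
          rw [mul_add, hx.2 z hz, hy.2 z hz, add_zero]⟩
      zero_mem' := ⟨fun g i j => map_zero (α g), fun z _ i j => mul_zero _⟩
      smul_mem' := fun c x hx => ⟨fun g i j => by
          change α g (c • x i j) = c • x i j
          rw [map_smul, hx.1], fun z hz i j => by
          change p * z * (c • x i j) = 0
          rw [mul_smul_comm, hx.2 z hz, smul_zero]⟩ }
  have hI : IsTwoSidedIdealIn (fixedAlgebra α π.rep ⊤) I := by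
    refine ⟨fun x hx => hmem.2 hx.1, fun b hb x hx => ?_⟩
    have hb' := hmem.1 hb
    refine ⟨⟨hmem.1 (mul_mem hb (hmem.2 hx.1)), fun z hz i j => ?_⟩,
      ⟨hmem.1 (mul_mem (hmem.2 hx.1) hb), fun z hz i j => ?_⟩⟩
    · rw [CStarMatrix.mul_apply, Finset.mul_sum]
      refine Finset.sum_eq_zero fun k _ => ?_
      rw [← mul_assoc, mul_assoc p]
      exact hx.2 _ (map_mul_eq hz fun g => hb' g i k) k j
    · rw [CStarMatrix.mul_apply, Finset.mul_sum]
      refine Finset.sum_eq_zero fun k _ => ?_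
      rw [← mul_assoc, hx.2 z hz, zero_mul]
  have hqI : diagonalOf π.rep.dim q ∈ I := by
    refine ⟨hmem.1 (diagonalOf_mem_fixedAlgebra hq trivial), fun z hz i j => ?_⟩
    rw [diagonalOf_apply]
    split_ifs
    · exact hpq z hz
    · exact mul_zero _
  have hIne : I ≠ ⊥ := fun hbot => diagonalOf_ne_zero hq0 π.rep.dim_pos
    ((Submodule.eq_bot_iff I).1 hbot _ hqI)
  -- There may be no unit, so $pp^*$ replaces $p$: the choice $z=p^*$ shows that it annihilates `I`.
  have hpp := h π hspec I hI hIne (diagonalOf _ (p * star p))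
    (diagonalOf_mem_fixedAlgebra (map_mul_eq hp (map_star_eq hp)) trivial) (fun x hx =>
      matrix_eq_zero_iff.2 fun i j => by
        rw [diagonalOf_mul_apply]
        exact hx.2 _ (map_star_eq hp) i j)
  exact diagonalOf_ne_zero (fun h0 => hp0 ((CStarRing.mul_star_self_eq_zero_iff p).1 h0))
    π.rep.dim_pos hpp

/-- The ideal `I` need not be closed. It is therefore replaced by `C`, the right annihilator of its
left annihilator `A`: both are closed and invariant, `I` lies in `C`, and fixed $p\in A$, $q\in C$
satisfy $pX^\alpha q=0$. -/
theorem IsFDynamicalSystem.isActionPrime_of_isFixedPrime (hα : IsFDynamicalSystem F α)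
    (h : IsFixedPrime α) : IsActionPrime α := by
  intro I hI hIα hI0 b _ hb
  by_contra hb0
  have hF := hα.dualPair
  let A : Submodule ℂ X :=
    { carrier := {x | ∀ y ∈ (I : Set X), x * y = 0}
      add_mem' := fun hx hy z hz => by rw [add_mul, hx z hz, hy z hz, add_zero]
      zero_mem' := fun z _ => zero_mul z
      smul_mem' := fun c x hx z hz => by rw [smul_mul_assoc, hx z hz, smul_zero] }
  let C : Submodule ℂ X :=
    { carrier := {x | ∀ y ∈ (A : Set X), y * x = 0}
      add_mem' := fun hx hy z hz => by rw [mul_add, hx z hz, hy z hz, add_zero]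
      zero_mem' := fun z _ => mul_zero z
      smul_mem' := fun c x hx z hz => by rw [mul_smul_comm, hx z hz, smul_zero] }
  have hAα : ∀ g, ∀ y ∈ A, α g y ∈ A := fun g y hy z hz => by
    rw [← apply_apply_inv α g z, ← map_mul, hy _ (hIα _ _ hz), map_zero]
  have hCα : ∀ g, ∀ y ∈ C, α g y ∈ C := fun g y hy z hz => by
    rw [← apply_apply_inv α g z, ← map_mul, hy _ (hAα _ _ hz), map_zero]
  have hAmul : ∀ y ∈ A, ∀ x, y * x ∈ A := fun y hy x z hz => by
    rw [mul_assoc]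
    exact hy _ (hI.2 x trivial z hz).1
  obtain ⟨p, hpA, hp0, hp⟩ := hα.exists_fixed_ne_zero (Y := A)
    (hF.isClosed_setOf_forall_eq_zero _ _ fun y _ => hF.continuous_mul_right y) hAα
    (fun y hy z _ => hAmul y hy _) hb hb0
  obtain ⟨c, hcI, hc0⟩ := Submodule.exists_mem_ne_zero_of_ne_bot hI0
  obtain ⟨q, hqC, hq0, hq⟩ := hα.exists_fixed_ne_zero (Y := C)
    (hF.isClosed_setOf_forall_eq_zero _ _ fun y _ => hF.continuous_mul_left y) hCα
    (fun y hy z _ w hw => by rw [← mul_assoc, hy w hw, zero_mul])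
    (fun y hy => hy c hcI : c ∈ C) hc0
  exact hq0 (h p q hp hq (fun z _ => hqC _ (hAmul p hpA z)) hp0)

/-! ### The spectrum and the Connes spectrum -/

/-- If $X_2(\pi)=0$, the spectral ideal of $X$ itself is zero and annihilated by $p\otimes1$ for any
nonzero fixed $p$. -/
theorem IsFDynamicalSystem.connesSpectrum_subset_spec [Nontrivial X]
    (hα : IsFDynamicalSystem F α) : connesSpectrum F α ⊆ spec F α := by
  intro π hπ
  rw [hα.mem_spec_iff]
  by_contra! hcon
  obtain ⟨p, hp0, hp⟩ := hα.exists_fixed_ne_zero_of_nontrivial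
  refine diagonalOf_ne_zero hp0 π.rep.dim_pos
    ((hα.dualPair.mem_specF_iff ⊤ π).1 (hπ ⊤ isInvariantHereditary_top) _
      (diagonalOf_mem_fixedAlgebra hp trivial) fun a ha => ?_)
  rw [hcon a ha, zero_mul]

theorem IsFDynamicalSystem.spec_subset_connesSpectrum [Nontrivial X]
    (hα : IsFDynamicalSystem F α) (h : ∀ π ∈ spec F α, IsFPrime (fixedAlgebra α π.rep ⊤)) :
    spec F α ⊆ connesSpectrum F α := by
  have hprime := hα.isFixedPrime_of_isFPrime h
  intro π hπ Y hY
  rw [hα.dualPair.mem_specF_iff]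
  intro b hb hbY
  by_contra hb0
  obtain ⟨e, he, he0⟩ := (hα.mem_spec_iff π).1 hπ
  have hJ : spectralIdeal α π.rep ⊤ ≠ ⊥ := by
    intro hbot
    have h1 : star e * e = 0 := (Submodule.eq_bot_iff _).1 hbot _
      (Submodule.subset_span ⟨e, he, e, he, rfl⟩)
    refine he0 (star_eq_zero.1 (matrix_eq_zero_of_mul_star_self_eq_zero ?_))
    rwa [star_star]
  -- Primeness makes the nonzero spectral ideal of $X$ essential, so `b` cannot annihilate it.
  obtain ⟨a, ha, hab⟩ : ∃ a ∈ spectralSubspaceTwo α π.rep ⊤, a * star b ≠ 0 := by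
    by_contra! hcon
    exact hb0 (h π hπ _ (spectralIdeal_isTwoSidedIdealIn α π.rep ⊤) hJ b
      (fixedAlgebra_mono_top hb) (forall_mul_spectralIdeal_eq_zero_iff.2 hcon))
  have hbY' : ∀ i j, (star b * b) i j ∈ Y := (mem_fixedAlgebra_iff.1 (mul_mem (star_mem hb) hb)).1
  have hv : a * star b ∈ spectralSubspaceTwo α π.rep ⊤ :=
    mul_mem_spectralSubspaceTwo ha (star_mem (fixedAlgebra_mono_top hb))
  obtain ⟨y₀, hy₀, hy₀0⟩ := hY.nonzero
  obtain ⟨p, hpY, hp0, hp⟩ := hα.exists_fixed_ne_zero (Y := Y.toSubmodule) hY.isClosed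
    hY.invariant (fun y hy z hz => mul_mem (s := Y) hy (star_mem (s := Y) hz)) hy₀ hy₀0
  obtain ⟨i, hi⟩ := exists_mul_star_apply_ne_zero hab
  have key : ∀ z, (∀ g, α g z = z) →
      diagonalOf π.rep.dim p * (diagonalOf π.rep.dim z * (a * star b)) = 0 := by
    intro z hz
    have hza : diagonalOf π.rep.dim p * (diagonalOf π.rep.dim z * a) ∈
        spectralSubspaceTwo α π.rep ⊤ :=
      mul_mem_spectralSubspaceTwo_of_fixed (entrywise_diagonalOf hp)
        (mul_mem_spectralSubspaceTwo_of_fixed (entrywise_diagonalOf hz) ha)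
    -- The entries have the form $YXY$, so the element lies in $Y_2(\pi)$ and is killed by $b^*$ on
    -- the right; the C*-identity, used twice, removes the extra factor $b^*b$ down to $b^*$.
    have hmem : diagonalOf π.rep.dim p * (diagonalOf π.rep.dim z * a) * (star b * b) ∈
        spectralSubspaceTwo α π.rep Y := by
      refine ⟨fun i j => ?_, (mul_mem_spectralSubspaceTwo hza
        (fixedAlgebra_mono_top (mul_mem (star_mem hb) hb))).2⟩
      rw [CStarMatrix.mul_apply]
      refine sum_mem fun k _ => ?_
      rw [diagonalOf_mul_apply]
      exact mul_mul_mem_of_hereditary hY.hereditary hpY (hbY' k j) _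
    have h1 := hbY _ hmem
    have h2 : diagonalOf π.rep.dim p * (diagonalOf π.rep.dim z * a) * (star b * b) = 0 := by
      refine matrix_eq_zero_of_mul_star_self_eq_zero ?_
      rw [star_mul, star_mul, star_star, ← mul_assoc, ← mul_assoc, h1, zero_mul, zero_mul]
    rw [← mul_assoc (diagonalOf _ z), ← mul_assoc]
    refine matrix_eq_zero_of_mul_star_self_eq_zero ?_
    rw [star_mul, star_star, ← mul_assoc, mul_assoc _ (star b) b, h2, zero_mul]
  refine hi (hprime p _ hp (fun g => map_mul_star_apply hv hv g i i) (fun z hz => ?_) hp0)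
  have h1 : diagonalOf π.rep.dim p * (diagonalOf π.rep.dim z *
      ((a * star b) * star (a * star b))) = 0 := by
    rw [← mul_assoc (diagonalOf _ z), ← mul_assoc (diagonalOf _ p), key z hz, zero_mul]
  have h2 := matrix_eq_zero_iff.1 h1 i i
  rwa [diagonalOf_mul_apply, diagonalOf_mul_apply, ← mul_assoc] at h2

theorem IsFDynamicalSystem.isFixedPrime_of_spec_subset (hα : IsFDynamicalSystem F α)
    (hprime : IsActionPrime α) (hsub : spec F α ⊆ connesSpectrum F α) : IsFixedPrime α := by
  intro p q₀ hp hq₀ hpq₀ hp0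
  by_contra hq₀0
  -- A self-adjoint $q$ is needed so that $q$ and $qXq$ lie in the self-adjoint algebra
  -- `fixedAnnihilator α p`.
  obtain ⟨q, hqdef⟩ : ∃ q, q = q₀ * star q₀ := ⟨_, rfl⟩
  have hq0 : q ≠ 0 := fun h0 => hq₀0 ((CStarRing.mul_star_self_eq_zero_iff q₀).1 (hqdef ▸ h0))
  have hqs : star q = q := by rw [hqdef, star_mul, star_star]
  have hq : ∀ g, α g q = q := hqdef ▸ map_mul_eq hq₀ (map_star_eq hq₀)
  have hpq : ∀ z, (∀ g, α g z = z) → p * z * q = 0 := fun z hz => by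
    rw [hqdef, ← mul_assoc, hpq₀ z hz, zero_mul]
  have hqY : ∀ x, q * x * q ∈ fixedAnnihilator α p := fun x z hz => by
    rw [star_mul, star_mul, hqs, ← mul_assoc, ← mul_assoc, ← mul_assoc, hpq z hz]
    simp
  have hH := hα.isInvariantHereditary_fixedAnnihilator hp
    (fun z hz => by rw [hqs, and_self]; exact hpq z hz) hq0
  have hspectral : ∀ π : GroupDual G, ∀ a ∈ spectralSubspaceTwo α π.rep ⊤, ∀ i j,
      p * a i j * q = 0 := by
    intro π a ha
    by_cases ha0 : a = 0
    · intro i j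
      rw [matrix_eq_zero_iff.1 ha0 i j, mul_zero, zero_mul]
    have hπ := hsub ((hα.mem_spec_iff π).2 ⟨a, ha, ha0⟩) _ hH
    rw [hα.dualPair.mem_specF_iff] at hπ
    let v := a * diagonalOf π.rep.dim q
    let w := diagonalOf π.rep.dim p * v
    have hv : v ∈ spectralSubspaceTwo α π.rep ⊤ :=
      mul_mem_spectralSubspaceTwo ha (diagonalOf_mem_fixedAlgebra hq trivial)
    have hw : w ∈ spectralSubspaceTwo α π.rep ⊤ :=
      mul_mem_spectralSubspaceTwo_of_fixed (entrywise_diagonalOf hp) hv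
    have hwapply : ∀ i j, w i j = p * a i j * q := fun i j => by
      simp only [w, v, diagonalOf_mul_apply, mul_diagonalOf_apply, mul_assoc]
    have hwY : star w * w ∈ fixedAlgebra α π.rep (fixedAnnihilator α p) := by
      refine ⟨fun i j => ?_, (star_mul_mem_fixedAlgebra hw hw).2⟩
      rw [CStarMatrix.mul_apply]
      refine sum_mem fun k _ => ?_
      rw [CStarMatrix.star_apply, hwapply, hwapply, star_mul, hqs]
      have := hqY (star (p * a k i) * (p * a k j))
      simpa only [mul_assoc] using this
    have hyw : ∀ y ∈ spectralSubspaceTwo α π.rep (fixedAnnihilator α p), y * star w = 0 := by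
      intro y hy
      -- The entries $Z$ of $yv^*$ are fixed, so $pZ^*$ kills the entries of $y$. Then $pZ^*Z=0$
      -- gives $Zp^*=0$, which is the entry of $yw^*$.
      have hZ : ∀ i j, p * star ((y * star v) i j) * (y * star v) i j = 0 := by
        intro i j
        conv_lhs => enter [2]; rw [CStarMatrix.mul_apply]
        rw [Finset.mul_sum]
        refine Finset.sum_eq_zero fun k _ => ?_
        rw [← mul_assoc, (hy.1 i k _ (map_star_eq fun g =>
          map_mul_star_apply (spectralSubspaceTwo_mono_top hy) hv g i j)).1, zero_mul]
      have h1 : y * star w = y * star v * diagonalOf π.rep.dim (star p) := by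
        rw [star_mul, star_diagonalOf, mul_assoc]
      rw [h1]
      refine matrix_eq_zero_iff.2 fun i j => ?_
      rw [mul_diagonalOf_apply, ← CStarRing.star_mul_self_eq_zero_iff, star_mul, star_star,
        ← mul_assoc, hZ, zero_mul]
    have hww : star w * w = 0 := hπ _ hwY fun y hy => by
      rw [star_mul, star_star, ← mul_assoc, hyw y hy, zero_mul]
    have hw0 : star w = 0 := matrix_eq_zero_of_mul_star_self_eq_zero (by rwa [star_star])
    intro i j
    rw [← hwapply]
    exact matrix_eq_zero_iff.1 (star_eq_zero.1 hw0) i j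
  have hF := hα.dualPair
  have hpXq : ∀ x, p * x * q = 0 := by
    intro x
    refine hF.eq_of_forall_eq fun φ hφ => ?_
    have hT : Continuous[fTopology F, fTopology F] (fun x => p * x * q) :=
      @Continuous.comp X X X (fTopology F) (fTopology F) (fTopology F) _ _
        (hF.continuous_mul_right q) (hF.continuous_mul_left p)
    obtain ⟨ψ, hψ, hψ'⟩ := exists_functional_comp
      ((LinearMap.mulRight ℂ q).comp (LinearMap.mulLeft ℂ p)) hT hφ
    have hψ'' : ∀ x, ψ x = φ (p * x * q) := hψ'
    rw [← hψ'', map_zero]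
    refine hα.functional_eq_zero (Y := ⊤) isClosed_univ_fTopology (fun _ _ _ => trivial)
      trivial hψ fun π a ha _ i j => ?_
    rw [hψ'', hspectral π a ha, map_zero]
  -- The invariant ideal annihilated by $pX$ contains $q$; $\alpha$-primeness then kills $pp^*$.
  let I : Submodule ℂ X :=
    { carrier := {x | ∀ y, p * y * x = 0}
      add_mem' := fun hx hy z => by rw [mul_add, hx, hy, add_zero]
      zero_mem' := fun z => mul_zero _
      smul_mem' := fun c x hx z => by rw [mul_smul_comm, hx, smul_zero] }
  have hI : IsTwoSidedIdealIn ⊤ I := by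
    refine ⟨fun _ _ => trivial, fun b _ x hx => ⟨fun y => ?_, fun y => ?_⟩⟩
    · rw [← mul_assoc, mul_assoc p, hx]
    · rw [← mul_assoc, hx, zero_mul]
  have hIα : ∀ g, ∀ x ∈ I, α g x ∈ I := by
    intro g x hx y
    rw [← apply_apply_inv α g y, ← hp g, ← map_mul, ← map_mul, hx, map_zero]
  have hI0 : I ≠ ⊥ := fun hbot => hq0 ((Submodule.eq_bot_iff I).1 hbot q hpXq)
  have hpp := hprime I hI hIα hI0 (p * star p) trivial fun x hx => hx (star p)
  exact hp0 ((CStarRing.mul_star_self_eq_zero_iff p).1 hpp)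

end CompactGroup

/-- Only $Y=X$ in the Connes spectrum is used: neither `b` nor `c` annihilates $X_2(\pi)$, so $ab^*$
and $ec$ are nonzero spectral elements, and $b(a^*Ee)c=0$ for matrices $E$ over $X^\alpha$ descends
to a relation in $X^\alpha$. -/
theorem IsFDynamicalSystem.isFPrime_of_isFixedPrime [Nontrivial X] {G : Type*} [Group G]
    [TopologicalSpace G] {α : G →* (X ≃⋆ₐ[ℂ] X)} (hα : IsFDynamicalSystem F α)
    (hprime : IsFixedPrime α) {π : GroupDual G} (hπ : π ∈ connesSpectrum F α) :
    IsFPrime (fixedAlgebra α π.rep ⊤) := by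
  have hess := (hα.dualPair.mem_specF_iff ⊤ π).1 (hπ ⊤ isInvariantHereditary_top)
  intro I hI hI0 b hb hbI
  by_contra hb0
  obtain ⟨c, hcI, hc0⟩ := Submodule.exists_mem_ne_zero_of_ne_bot hI0
  have hc := hI.1 c hcI
  obtain ⟨a, ha, hab⟩ : ∃ a ∈ spectralSubspaceTwo α π.rep ⊤, a * star b ≠ 0 := by
    by_contra! hcon
    exact hb0 (hess b hb hcon)
  obtain ⟨e, he, hec⟩ : ∃ e ∈ spectralSubspaceTwo α π.rep ⊤, e * c ≠ 0 := by
    by_contra! hcon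
    refine hc0 (star_eq_zero.1 (hess (star c) (star_mem hc) fun e he => ?_))
    rw [star_star, hcon e he]
  have hu := mul_mem_spectralSubspaceTwo ha (star_mem hb)
  have hv := mul_mem_spectralSubspaceTwo he hc
  obtain ⟨k, hk⟩ := exists_mul_star_apply_ne_zero hab
  obtain ⟨l, hl⟩ := exists_mul_star_apply_ne_zero hec
  have key : ∀ z, (∀ g, α g z = z) → ∀ i j,
      star ((a * star b) k i) * z * (e * c) l j = 0 := by
    intro z hz i j
    -- A matrix unit with coefficient $z\in X^\alpha$ isolates row `k` of $ab^*$ and row `l` of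
    -- $ec$.
    let E : CStarMatrix (Fin π.rep.dim) (Fin π.rep.dim) X :=
      CStarMatrix.ofMatrix fun r s => if r = k ∧ s = l then z else 0
    have hE : ∀ r s, E r s = if r = k ∧ s = l then z else 0 := fun _ _ => rfl
    have hEfix : ∀ g, entrywise (α g) E = E := fun g => by
      ext r s
      rw [entrywise_apply, hE]
      split_ifs
      · exact hz g
      · exact map_zero _
    have h1 : b * (star a * E * e * c) = 0 :=
      hbI _ (hI.2 _ (star_mul_mul_mem_fixedAlgebra ha hEfix he) _ hcI).1
    have h2 : star (a * star b) * E * (e * c) = 0 := by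
      rw [star_mul, star_star, ← h1]
      simp only [mul_assoc]
    have h3 := matrix_eq_zero_iff.1 h2 i j
    rw [CStarMatrix.mul_apply, Finset.sum_eq_single l (fun s _ hs => ?_) (by simp)] at h3
    · rw [CStarMatrix.mul_apply, Finset.sum_eq_single k (fun r _ hr => ?_) (by simp)] at h3
      · rwa [hE, if_pos ⟨rfl, rfl⟩, CStarMatrix.star_apply] at h3
      · rw [hE, if_neg fun hc => hr hc.1, mul_zero]
    · rw [CStarMatrix.mul_apply, Finset.sum_eq_zero fun r _ => ?_, zero_mul]
      rw [hE, if_neg fun hc => hs hc.2, mul_zero]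
  refine hl (hprime _ _ (fun g => map_mul_star_apply hu hu g k k)
    (fun g => map_mul_star_apply hv hv g l l) (fun z hz => ?_) hk)
  rw [CStarMatrix.mul_apply, CStarMatrix.mul_apply, Finset.sum_mul, Finset.sum_mul]
  refine Finset.sum_eq_zero fun i _ => ?_
  rw [Finset.mul_sum]
  refine Finset.sum_eq_zero fun j _ => ?_
  have := key z hz i j
  rw [CStarMatrix.star_apply, mul_assoc (a := (a * star b) k i), mul_assoc (a := (a * star b) k i),
    ← mul_assoc (star _ * z), this, zero_mul, mul_zero]

end FixedPoints

end CompactAction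

end

open CompactAction
theorem theorem4p3 {X : Type*} [NonUnitalCStarAlgebra X] [PartialOrder X] [StarOrderedRing X]
    [Nontrivial X] {G : Type*} [Group G] [TopologicalSpace G] [IsTopologicalGroup G]
    [CompactSpace G] [T2Space G] [MeasurableSpace G] [BorelSpace G]
    (F : Submodule ℂ (StrongDual ℂ X)) (α : G →* (X ≃⋆ₐ[ℂ] X)) (hα : IsFDynamicalSystem F α) :
    (∀ π ∈ spec F α, IsFPrime (fixedAlgebra α π.rep ⊤)) ↔
      (IsActionPrime α ∧ spec F α = connesSpectrum F α) := by
  constructor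
  · intro h
    exact ⟨hα.isActionPrime_of_isFixedPrime (hα.isFixedPrime_of_isFPrime h),
      (hα.spec_subset_connesSpectrum h).antisymm hα.connesSpectrum_subset_spec⟩
  · rintro ⟨h1, h2⟩ π hπ
    exact hα.isFPrime_of_isFixedPrime (hα.isFixedPrime_of_spec_subset h1 h2.le) (h2 ▸ hπ)
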